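/- **Setting.** Let $B$ be an integral scheme and $0\in B$ a closed point whose local ring is a discrete valuation ring (for instance a smooth curve, or the spectrum of a DVR). Let $\pi:\mathcal V\to B$ be a morphism from an integral, locally Noetherian scheme (the family of ambient spaces), and write $V_0=\pi^{-1}(0)$. Let $\mathcal D=\sum_j\mathcal D_j$ be a finite sum of pairwise distinct, integral, effective Cartier divisors on $\mathcal V$ (the branch divisor and its components), none of which is contained in $V_0$. Let $\mathcal Z\subset\mathcal V$ be an integral closed subscheme which is regularly embedded of codimension $c\ge 2$ (locally cut out by a regular sequence of length $c$), with $\mathcal Z\not\subset V_0$ and $\mathcal Z\cap V_0\neq\emptyset$. Let $a$ be the multiplicity of $\mathcal D$ along $\mathcal Z$ (the order of vanishing at the generic point of $\mathcal Z$), let $\sigma:\widetilde{\mathcal V}\to\mathcal V$ be the blow-up along $\mathcal Z$, with exceptional divisor $\mathcal E$, put $\widetilde V_0=\sigma^{-1}(V_0)$, and let $$\mathcal D^*=\sigma^*\mathcal D-2\lfloor a/2\rfloor\,\mathcal E .$$ A double cover of an integral scheme $W$ branched along a closed set $S$ is a finite morphism of degree two $X\to W$, with $X$ normal and integral, whose geometric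 fibers consist of one point over $S$ and of two points over $W\setminus S$. The branch locus of a morphism is the set of points over which the geometric fiber is a single point. **Statement.** Suppose that some component $\mathcal D_i$ of $\mathcal D$ satisfies $\mathcal Z\cap V_0\subset\mathcal D_i$ and $\mathcal Z\not\subset\mathcal D_i$. Then $\mathcal D^*$ is an effective Cartier divisor, $\mathcal E\cap\widetilde V_0$ is non-empty, and every irreducible component $F$ of $\mathcal E\cap\widetilde V_0$ has the following properties. 1. $F$ is an irreducible component of $\operatorname{Supp}\mathcal D^*\cap\widetilde V_0$. 2. $F$ is new: the closure of $\sigma(F)$ is not an irreducible component of $\operatorname{Supp}\mathcal D\cap V_0$; in particular $F$ is not the strict transform of such a component. 3. $F$ lies in the strict transform of $\mathcal D_i$. Consequently, if $\widetilde{\mathcal X}\to\widetilde{\mathcal V}$ is any double cover branched along $\mathcal D^*$, with special fiber $\widetilde X_0\to\widetilde V_0$, then $F$ is an irreducible component of the branch locus of $\widetilde X_0\to\widetilde V_0$; and if $\mathcal X\to\mathcal V$ is any double cover branched along $\mathcal D$, with special fiber $X_0\to V_0$, then the closure of $\sigma(F)$ is not an irreducible component of the branch locus of $X_0\to V_0$.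 -/

import Mathlib

open CategoryTheory CategoryTheory.Limits AlgebraicGeometry

universe u

noncomputable section

namespace JumpingMultiplicity

/-- The irreducible components of a subset `s` of a topological space. -/
def componentsIn {α : Type u} [TopologicalSpace α] (s : Set α) : Set (Set α) :=
  {F | Maximal (fun t => IsIrreducible t ∧ t ⊆ s) F}

/-- An ideal sheaf is (the ideal sheaf of) an effective Cartier divisor if it is locally generated
by one nonzerodivisor. For such ideal sheaves the sum of divisors is the product of ideals, and the
pullback of a divisor is the inverse image ideal sheaf `comap`. -/
def IsEffectiveCartier {X : Scheme.{u}} (I : X.IdealSheafData) : Prop :=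
  ∀ x : X, ∃ U : X.affineOpens, x ∈ U.1 ∧
    ∃ f ∈ nonZeroDivisors Γ(X, U.1), I.ideal U = Ideal.span {f}

/-- The closed subscheme cut out by `Z` is regularly embedded of codimension `c`: around each of
its points, its ideal is generated by a regular sequence of length `c`. -/
def IsRegularlyEmbedded {V : Scheme.{u}} (Z : V.IdealSheafData) (c : ℕ) : Prop :=
  ∀ x ∈ Z.support, ∃ U : V.affineOpens, x ∈ U.1 ∧
    ∃ rs : List Γ(V, U.1), rs.length = c ∧
      RingTheory.Sequence.IsRegular Γ(V, U.1) rs ∧ Z.ideal U = Ideal.ofList rs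

/-- The blow-up along the closed subscheme cut out by `Z`, given by its universal property: the
inverse image of the center is an effective Cartier divisor (the exceptional divisor), and the
morphism is terminal with this property. -/
structure IsBlowUp {V V' : Scheme.{u}} (Z : V.IdealSheafData) (σ : V' ⟶ V) : Prop where
  cartier : IsEffectiveCartier (Z.comap σ)
  lift : ∀ (T : Scheme.{u}) (f : T ⟶ V), IsEffectiveCartier (Z.comap f) →
    ∃! g : T ⟶ V', g ≫ σ = f

/-- The ideal of `D` in the local ring at `x` lies in the `n`-th power of the maximal ideal. -/
def VanishesToOrder {V : Scheme.{u}} (D : V.IdealSheafData) (x : V) (n : ℕ) : Prop :=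
  ∀ (U : V.affineOpens) (hx : x ∈ U.1),
    (D.ideal U).map (V.presheaf.germ U.1 x hx).hom ≤
      IsLocalRing.maximalIdeal (V.presheaf.stalk x) ^ n

/-- `a` is the multiplicity of `D` along the irreducible closed subscheme cut out by `Z`, that is,
its order of vanishing at the generic point of `Z`. -/
def IsMultiplicity {V : Scheme.{u}} (D Z : V.IdealSheafData) (a : ℕ) : Prop :=
  ∀ η : V, IsGenericPoint η (Z.support : Set V) → IsGreatest {n | VanishesToOrder D η n} a

/-- The strict transform of a closed subset `S` under the blow-up `σ` with center `Z`. -/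
def strictTransform {V V' : Scheme.{u}} (Z : V.IdealSheafData) (σ : V' ⟶ V) (S : Set V) :
    Set V' :=
  closure (σ ⁻¹' (S \ Z.support))

/-- The number of points in the fiber of `p` over the geometric point `y`. -/
def geometricFiberCard {X V : Scheme.{u}} (p : X ⟶ V) {Ω : Type u} [Field Ω]
    (y : Spec (.of Ω) ⟶ V) : ℕ :=
  Nat.card {x : Spec (.of Ω) ⟶ X // x ≫ p = y}

/-- The branch locus of `p`: the points whose geometric fiber is a single point. -/
def branchLocus {X V : Scheme.{u}} (p : X ⟶ V) : Set V :=
  {v | ∀ (Ω : Type u) [Field Ω] [IsAlgClosed Ω] (y : Spec (.of Ω) ⟶ V),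
    y (IsLocalRing.closedPoint Ω) = v → geometricFiberCard p y = 1}

/-- A double cover of `V` branched along `S`: a finite morphism of degree two from a normal
integral scheme, whose geometric fibers are single points over `S` and pairs of points elsewhere. -/
structure IsDoubleCover {X V : Scheme.{u}} (p : X ⟶ V) (S : Set V) : Prop where
  integral : IsIntegral X
  normal : ∀ x : X, IsIntegrallyClosed (X.presheaf.stalk x)
  finite : IsFinite p
  degree : ∀ η : V, IsGenericPoint η (Set.univ : Set V) → p.finrank η = 2
  fiber_of_mem : ∀ (Ω : Type u) [Field Ω] [IsAlgClosed Ω] (y : Spec (.of Ω) ⟶ V),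
    y (IsLocalRing.closedPoint Ω) ∈ S → geometricFiberCard p y = 1
  fiber_of_notMem : ∀ (Ω : Type u) [Field Ω] [IsAlgClosed Ω] (y : Spec (.of Ω) ⟶ V),
    y (IsLocalRing.closedPoint Ω) ∉ S → geometricFiberCard p y = 2

/-- For a family of double covers `p : X ⟶ V` over `π : V ⟶ B`: the branch locus of the fiber
`X_b ⟶ V_b` of `p` over the point `b`, as a subset of `V`. -/
def fiberBranchLocus {X V B : Scheme.{u}} (p : X ⟶ V) (π : V ⟶ B) (b : B) : Set V :=
  π.fiberι b '' branchLocus (pullback.snd p (π.fiberι b))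

end JumpingMultiplicity

end

open JumpingMultiplicity

/-! Let $f$ be the generic point of a component $F$ of $\mathcal E\cap\widetilde V_0$. Near $f$ the
divisor $\mathcal E$ has one equation $e$, and among the generizations of $f$ the fiber $\widetilde
V_0$ is detected by one function $t$, the pullback of the numerator of a uniformizer at $0$. Let $d$
be an equation of $\mathcal D_i$ near $\sigma(f)$. Everything follows from the primality of $e$ and
from counting codimensions.

Since $\mathcal Z$ is regularly embedded and integral, the associated graded ring of its ideal $I$
is a polynomial ring over a domain. Hence $e$ is a prime element and $(e)$ contracts to $I$
(`AdaptedChart.isPrime_span_and_comap_eq`). As $\mathcal Z\not\subset\mathcal D_i$, $e$ does not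
divide $d$, while $d$ vanishes at $f$ because $\sigma(f)\in\mathcal Z\cap V_0\subset\mathcal D_i$. A
prime $e$ not dividing $d$ can be cancelled from multiples of $d$, so subtracting multiples of
$\mathcal E$ leaves $f$ in the support of $\mathcal D^*$ (`mem_support_of_mul_pow_eq`). A minimal
prime of $(d)$ below $f$ avoids $e$, which puts $f$ in the strict transform (`mem_strictTransform`).

By Krull, $f$ has codimension at most 2. A proper generization $y$ of $f$ in
$\operatorname{Supp}\mathcal D^*\cap\widetilde V_0$ would lie outside $\mathcal E$, where $\sigma$
preserves codimension, so $\sigma(y)$ would have codimension at most 1. But $\sigma(y)$ lies on some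
$\mathcal D_j$ and on $V_0\not\supset\mathcal D_j$, so its codimension is at least 2. Thus $F$ is a
component (`eq_of_specializes_of_mem_support`). It is new because $\sigma(f)$ has codimension at
least 3, by $c\ge 2$ and $\mathcal Z\not\subset V_0$, whereas components of $\mathcal D_i\cap V_0$
have codimension at most 2 (`exists_specializes_ne`).

The divisor $\mathcal D^*$ exists because order $a$ at the generic point of $\mathcal Z$ already
means lying in $I^a$ (`IsBlowUp.exists_mul_eq_comap`). The statements on double covers follow since
counting geometric points commutes with base change. -/

namespace JumpingMultiplicity

/-! ### Powers of an ideal generated by a regular sequence. -/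

section

section QuasiRegular

variable {R : Type*} [CommRing R]

/-- The consequences of the freeness of the associated graded ring of `J` over `R ⧸ J` and of its
being a polynomial ring, expressed by the elements of the powers of `J`. -/
structure IsQuasiRegular (J : Ideal R) : Prop where
  mem_of_mul_mem : ∀ K : Ideal R, J ≤ K → ∀ y : R, (∀ r, y * r ∈ K → r ∈ K) →
    ∀ n, ∀ j ∈ J ^ n, y * j ∈ K * J ^ n → j ∈ K * J ^ n
  mem_or_mem : ∀ K : Ideal R, J ≤ K → K.IsPrime → ∀ m n, ∀ f ∈ J ^ m, ∀ g ∈ J ^ n,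
    f * g ∈ K * J ^ (m + n) → f ∈ K * J ^ m ∨ g ∈ K * J ^ n

lemma isQuasiRegular_bot : IsQuasiRegular (⊥ : Ideal R) where
  mem_of_mul_mem K _ y hy n j hj h := by
    cases n with
    | zero => simpa using hy j (by simpa using h)
    | succ n => simp_all [pow_succ]
  mem_or_mem K _ hK m n f hf g hg h := by
    cases m with
    | succ m => left; simp_all [pow_succ]
    | zero =>
      cases n with
      | succ n => right; simp_all [pow_succ]
      | zero => simpa using hK.mem_or_mem (by simpa using h)

lemma pow_sup_span_singleton (J : Ideal R) (x : R) (n : ℕ) :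
    (J ⊔ Ideal.span {x}) ^ (n + 1) =
      Ideal.span {x} * (J ⊔ Ideal.span {x}) ^ n ⊔ J ^ (n + 1) := by
  induction n with
  | zero => simp [sup_comm]
  | succ n ih =>
    apply le_antisymm
    · rw [pow_succ' _ (n + 1)]
      conv_lhs => enter [1]; rw [sup_comm]
      rw [Ideal.sup_mul]
      refine sup_le le_sup_left ?_
      conv_lhs => rw [ih]
      rw [Ideal.mul_sup]
      refine sup_le (le_sup_of_le_left ?_) (le_sup_of_le_right (by rw [← pow_succ']))
      rw [mul_left_comm, pow_succ' _ n]
      exact Ideal.mul_mono_right (Ideal.mul_mono_left le_sup_left)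
    · refine sup_le ?_ (Ideal.pow_right_mono le_sup_left _)
      rw [pow_succ' _ (n + 1)]
      exact Ideal.mul_mono_left le_sup_right

lemma mem_mul_pow_sup_iff {J K : Ideal R} {x r : R} {n : ℕ} :
    r ∈ K * (J ⊔ Ideal.span {x}) ^ (n + 1) ↔
      ∃ s ∈ K * (J ⊔ Ideal.span {x}) ^ n, ∃ j ∈ K * J ^ (n + 1), x * s + j = r := by
  rw [pow_sup_span_singleton, Ideal.mul_sup, mul_left_comm, Submodule.mem_sup]
  constructor
  · rintro ⟨a, ha, b, hb, rfl⟩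
    obtain ⟨s, hs, rfl⟩ := Ideal.mem_span_singleton_mul.mp ha
    exact ⟨s, hs, b, hb, rfl⟩
  · rintro ⟨s, hs, j, hj, rfl⟩
    exact ⟨_, Ideal.mem_span_singleton_mul.mpr ⟨s, hs, rfl⟩, j, hj, rfl⟩

lemma mem_pow_sup_iff {J : Ideal R} {x r : R} {n : ℕ} :
    r ∈ (J ⊔ Ideal.span {x}) ^ (n + 1) ↔
      ∃ s ∈ (J ⊔ Ideal.span {x}) ^ n, ∃ j ∈ J ^ (n + 1), x * s + j = r := by
  simpa using mem_mul_pow_sup_iff (K := ⊤) (J := J) (x := x) (r := r) (n := n)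

namespace IsQuasiRegular

variable {J : Ideal R} (hJ : IsQuasiRegular J) {x : R} (hx : ∀ r, x * r ∈ J → r ∈ J)

include hJ in
lemma mem_pow_of_mul_mem_pow {x : R} (hx : ∀ r, x * r ∈ J → r ∈ J) (n : ℕ) (r : R)
    (h : x * r ∈ J ^ n) : r ∈ J ^ n := by
  induction n with
  | zero => simp
  | succ n ih =>
    rw [pow_succ'] at h ⊢
    have h' : x * r ∈ J ^ n := (Ideal.mul_le_right : J * J ^ n ≤ J ^ n) h
    exact hJ.mem_of_mul_mem J le_rfl x hx n r (ih h') h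

include hJ hx in
-- This is the splitting of the degree $n+1$ part of the graded ring of $J+(x)$, reduced modulo $K$,
-- into $x$ times its degree $n$ part and the degree $n+1$ part for $J$. Two expressions $xs+j$ are
-- compared: the difference of the coefficients of $x$ lies in $J^{n+1}$, because $x$ is regular
-- modulo $J$ and hence modulo its powers.
lemma mem_and_mem {K : Ideal R} (hK : J ⊔ Ideal.span {x} ≤ K) {y : R}
    (hy : ∀ r, y * r ∈ K → r ∈ K) {n : ℕ} {s j : R}
    (hj : j ∈ J ^ (n + 1)) (h : y * (x * s + j) ∈ K * (J ⊔ Ideal.span {x}) ^ (n + 1)) :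
    y * s ∈ K * (J ⊔ Ideal.span {x}) ^ n ∧ j ∈ K * J ^ (n + 1) := by
  obtain ⟨u, hu, v, hv, huv⟩ := mem_mul_pow_sup_iff.mp h
  have hJK : J ≤ K := le_sup_left.trans hK
  have hxK : x ∈ K := hK (le_sup_right (a := J) (Ideal.mem_span_singleton_self x))
  have hv' : v ∈ J ^ (n + 1) := (Ideal.mul_le_right : K * J ^ (n + 1) ≤ J ^ (n + 1)) hv
  have hw : y * s - u ∈ J ^ (n + 1) := by
    apply hJ.mem_pow_of_mul_mem_pow hx
    have : x * (y * s - u) = v - y * j := by linear_combination -huv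
    rw [this]
    exact sub_mem hv' (Ideal.mul_mem_left _ _ hj)
  constructor
  · have : y * s = u + (y * s - u) := by ring
    rw [this]
    refine add_mem hu ?_
    rw [pow_succ'] at hw
    have hle : J * J ^ n ≤ K * (J ⊔ Ideal.span {x}) ^ n :=
      Ideal.mul_mono hJK (Ideal.pow_right_mono le_sup_left n)
    exact hle hw
  · refine hJ.mem_of_mul_mem K hJK y hy _ j hj ?_
    have : y * j = v - x * (y * s - u) := by linear_combination -huv
    rw [this]
    exact sub_mem hv (Ideal.mul_mem_mul hxK hw)

include hJ hx in
-- Adjoining $x$ amounts to adjoining a polynomial variable to the graded ring. Regularity is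
-- checked coefficient by coefficient, and the absence of zero divisors is proved by comparing the
-- terms free of $x$.
lemma sup_span_singleton : IsQuasiRegular (J ⊔ Ideal.span {x}) := by
  have key : ∀ K : Ideal R, J ⊔ Ideal.span {x} ≤ K → ∀ y : R, (∀ r, y * r ∈ K → r ∈ K) →
      ∀ n, ∀ j ∈ (J ⊔ Ideal.span {x}) ^ n, y * j ∈ K * (J ⊔ Ideal.span {x}) ^ n →
        j ∈ K * (J ⊔ Ideal.span {x}) ^ n := by
    intro K hK y hy n
    induction n with
    | zero => intro j _ h; simpa using hy j (by simpa using h)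
    | succ n ih =>
      intro r hr h
      obtain ⟨s, hs, j, hj, rfl⟩ := mem_pow_sup_iff.mp hr
      obtain ⟨h1, h2⟩ := hJ.mem_and_mem hx hK hy hj h
      exact mem_mul_pow_sup_iff.mpr ⟨s, ih s hs h1, j, h2, rfl⟩
  refine ⟨key, fun K hK hKp ↦ ?_⟩
  suffices H : ∀ N m n, m + n = N → ∀ f ∈ (J ⊔ Ideal.span {x}) ^ m,
      ∀ g ∈ (J ⊔ Ideal.span {x}) ^ n, f * g ∈ K * (J ⊔ Ideal.span {x}) ^ (m + n) →
      f ∈ K * (J ⊔ Ideal.span {x}) ^ m ∨ g ∈ K * (J ⊔ Ideal.span {x}) ^ n from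
    fun m n ↦ H _ m n rfl
  have hJK : J ≤ K := le_sup_left.trans hK
  have h1 : ∀ r, (1 : R) * r ∈ K → r ∈ K := by simp
  have hpow : ∀ k, K * J ^ k ≤ K * (J ⊔ Ideal.span {x}) ^ k := fun k ↦
    Ideal.mul_mono_right (Ideal.pow_right_mono le_sup_left k)
  have hreg : ∀ f ∉ K, ∀ r, f * r ∈ K → r ∈ K := fun f hf r h ↦
    (hKp.mem_or_mem h).resolve_left hf
  intro N
  induction N with
  | zero =>
    intro m n hmn f _ g _ h
    obtain ⟨rfl, rfl⟩ : m = 0 ∧ n = 0 := by omega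
    simpa using hKp.mem_or_mem (by simpa using h)
  | succ N ih =>
    intro m n hmn f hf g hg h
    rcases m with _ | m
    · by_cases hfK : f ∈ K
      · left; simpa using hfK
      · right; exact key K hK f (hreg f hfK) _ g hg (by simpa using h)
    rcases n with _ | n
    · by_cases hgK : g ∈ K
      · right; simpa using hgK
      · left; exact key K hK g (hreg g hgK) _ f hf (by simpa [mul_comm] using h)
    obtain ⟨s, hs, j, hj, rfl⟩ := mem_pow_sup_iff.mp hf
    obtain ⟨s', hs', j', hj', rfl⟩ := mem_pow_sup_iff.mp hg
    have hjj' : j * j' ∈ J ^ (m + n + 1 + 1) := by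
      have := Ideal.mul_mem_mul hj hj'
      rw [← pow_add] at this
      convert this using 2; omega
    have e : m + 1 + (n + 1) = m + n + 1 + 1 := by omega
    rw [e] at h
    -- The part of $fg$ free of $x$ is $jj'$.
    have h2 := (hJ.mem_and_mem (y := 1) hx hK h1 (n := m + n + 1)
      (s := s * (x * s' + j') + j * s') hjj' (by convert h using 1; ring)).2
    -- Once the negligible one of $j$, $j'$ is subtracted, the product is divisible by $x$.
    -- Cancelling $x$ lowers the total degree by one.
    rcases hJ.mem_or_mem K hJK hKp (m + 1) (n + 1) j hj j' hj' (by rwa [e]) with hK' | hK'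
    · have h3 := (hJ.mem_and_mem (y := 1) hx hK h1 (n := m + n + 1) (j := 0)
        (s := s * (x * s' + j')) (zero_mem _) (by
          have e2 : 1 * (x * (s * (x * s' + j')) + 0) =
            (x * s + j) * (x * s' + j') - j * (x * s' + j') := by ring
          rw [e2]
          refine sub_mem h ?_
          have := Ideal.mul_mem_mul (hpow (m + 1) hK') hg
          rw [mul_assoc, ← pow_add, e] at this
          exact this)).1
      rw [one_mul] at h3
      rcases ih m (n + 1) (by omega) s hs _ hg h3 with h4 | h4
      · exact .inl (mem_mul_pow_sup_iff.mpr ⟨s, h4, j, hK', rfl⟩)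
      · exact .inr h4
    · have h3 := (hJ.mem_and_mem (y := 1) hx hK h1 (n := m + n + 1) (j := 0)
        (s := (x * s + j) * s') (zero_mem _) (by
          have e2 : 1 * (x * ((x * s + j) * s') + 0) =
            (x * s + j) * (x * s' + j') - j' * (x * s + j) := by ring
          rw [e2]
          refine sub_mem h ?_
          have := Ideal.mul_mem_mul (hpow (n + 1) hK') hf
          rw [mul_assoc, ← pow_add, add_comm, e] at this
          exact this)).1
      rw [one_mul] at h3
      have e3 : m + n + 1 = m + 1 + n := by omega
      rw [e3] at h3
      rcases ih (m + 1) n (by omega) _ hf s' hs' h3 with h4 | h4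
      · exact .inl h4
      · exact .inr (mem_mul_pow_sup_iff.mpr ⟨s', h4, j', hK', rfl⟩)

end IsQuasiRegular

/-- Induction on the last element, which is regular modulo its predecessors. The second assertion
says that each generator is nonzero in $J/KJ$; this makes it usable as the denominator of a blow-up
chart. -/
lemma isQuasiRegular_ofList {rs : List R} (h : RingTheory.Sequence.IsWeaklyRegular R rs) :
    IsQuasiRegular (Ideal.ofList rs) ∧
      ∀ x ∈ rs, ∀ K : Ideal R, Ideal.ofList rs ≤ K → K ≠ ⊤ → x ∉ K * Ideal.ofList rs := by
  induction rs using List.reverseRecOn with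
  | nil => simpa using isQuasiRegular_bot
  | append_singleton l x ih =>
    obtain ⟨h1, h2⟩ := (RingTheory.Sequence.isWeaklyRegular_append_iff _ _ _).mp h
    rw [RingTheory.Sequence.isWeaklyRegular_singleton_iff] at h2
    obtain ⟨hJ, hJ'⟩ := ih h1
    have hx : ∀ r, x * r ∈ Ideal.ofList l → r ∈ Ideal.ofList l := by
      intro r hr
      have e : (Ideal.ofList l • ⊤ : Submodule R R) = Ideal.ofList l := by simp
      rw [e] at h2
      have := h2 (a₁ := Submodule.Quotient.mk r) (a₂ := 0) (by
        change x • _ = x • _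
        rw [smul_zero, ← Submodule.Quotient.mk_smul, Submodule.Quotient.mk_eq_zero]
        simpa using hr)
      rwa [Submodule.Quotient.mk_eq_zero] at this
    rw [Ideal.ofList_append, Ideal.ofList_singleton]
    refine ⟨hJ.sup_span_singleton hx, fun z hz K hK hKt hzK ↦ ?_⟩
    rw [← pow_one (Ideal.ofList l ⊔ Ideal.span {x})] at hzK
    have h1 : ∀ r, (1 : R) * r ∈ K → r ∈ K := by simp
    rcases List.mem_append.mp hz with hz | hz
    · have hzl : z ∈ Ideal.ofList l := Ideal.subset_span hz
      have := (hJ.mem_and_mem hx hK h1 (n := 0) (s := 0) (j := z) (by simpa using hzl)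
        (by simpa using hzK)).2
      exact hJ' z hz K (le_sup_left.trans hK) hKt (by simpa using this)
    · obtain rfl : z = x := by simpa using hz
      have := (hJ.mem_and_mem hx hK h1 (n := 0) (s := 1) (j := 0) (zero_mem _)
        (by simpa using hzK)).1
      exact hKt ((Ideal.eq_top_iff_one K).mpr (by simpa using this))

end QuasiRegular

end

/-! ### The affine blow-up algebra. -/

section

section BlowUpAlgebra

variable {R : Type*} [CommRing R]

/-- The affine blow-up algebra `R[I/x]`, as a subalgebra of the localization of `R` at `x`. -/
def blowUpAlgebra (I : Ideal R) (x : R) : Subalgebra R (Localization.Away x) :=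
  Algebra.adjoin R {a | ∃ y ∈ I, a * algebraMap R _ x = algebraMap R _ y}

namespace blowUpAlgebra

variable {I : Ideal R} {x : R}

lemma isUnit_algebraMap : IsUnit (algebraMap R (Localization.Away x) x) :=
  IsLocalization.Away.algebraMap_isUnit x

lemma mul_left_inj' {a b : blowUpAlgebra I x}
    (h : a * algebraMap R _ x = b * algebraMap R _ x) : a = b := by
  have h' := congrArg (Subtype.val) h
  exact Subtype.ext ((isUnit_algebraMap (x := x)).mul_left_inj.mp h')

lemma algebraMap_mem_nonZeroDivisors :
    algebraMap R (blowUpAlgebra I x) x ∈ nonZeroDivisors (blowUpAlgebra I x) := by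
  rw [mem_nonZeroDivisors_iff_right]
  exact fun z hz ↦ mul_left_inj' (by rw [hz, zero_mul])

lemma mul_pow_left_inj {a b : blowUpAlgebra I x} {n : ℕ}
    (h : a * algebraMap R _ x ^ n = b * algebraMap R _ x ^ n) : a = b := by
  induction n with
  | zero => simpa using h
  | succ n ih =>
    simp only [pow_succ, ← mul_assoc] at h
    exact ih (mul_left_inj' h)

lemma exists_mul_eq {y : R} (hy : y ∈ I) :
    ∃ a : blowUpAlgebra I x, a * algebraMap R _ x = algebraMap R _ y := by
  obtain ⟨u, hu⟩ := isUnit_algebraMap (x := x)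
  have h : algebraMap R (Localization.Away x) y * ↑u⁻¹ * algebraMap R _ x = algebraMap R _ y := by
    rw [← hu, mul_assoc, Units.inv_mul, mul_one]
  exact ⟨⟨_, Algebra.subset_adjoin ⟨y, hy, h⟩⟩, Subtype.ext h⟩

lemma exists_mul_pow_eq_of_mem {n : ℕ} {f : R} (hf : f ∈ I ^ n) :
    ∃ a : blowUpAlgebra I x, a * algebraMap R _ x ^ n = algebraMap R _ f := by
  induction n generalizing f with
  | zero => exact ⟨algebraMap R _ f, by simp⟩
  | succ n ih =>
    rw [pow_succ] at hf
    induction hf using Submodule.mul_induction_on' with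
    | mem_mul_mem g hg y hy =>
      obtain ⟨a, ha⟩ := ih hg
      obtain ⟨b, hb⟩ := exists_mul_eq (x := x) hy
      refine ⟨a * b, ?_⟩
      rw [map_mul, ← ha, ← hb]; ring
    | add f _ g _ hf hg =>
      obtain ⟨a, ha⟩ := hf
      obtain ⟨b, hb⟩ := hg
      exact ⟨a + b, by rw [add_mul, ha, hb, map_add]⟩

lemma exists_mul_pow_eq (hx : x ∈ I) (a : blowUpAlgebra I x) :
    ∃ n, ∃ f ∈ I ^ n, a * algebraMap R _ x ^ n = algebraMap R _ f := by
  obtain ⟨a, ha⟩ := a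
  suffices H : ∃ n, ∃ f ∈ I ^ n, a * algebraMap R _ x ^ n = algebraMap R _ f by
    obtain ⟨n, f, hf, h⟩ := H
    exact ⟨n, f, hf, Subtype.ext h⟩
  induction ha using Algebra.adjoin_induction with
  | mem a h =>
    obtain ⟨y, hy, h⟩ := h
    exact ⟨1, y, by simpa using hy, by simpa using h⟩
  | algebraMap r => exact ⟨0, r, by simp, by simp⟩
  | add a b _ _ ha hb =>
    obtain ⟨n, f, hf, ha⟩ := ha
    obtain ⟨m, g, hg, hb⟩ := hb
    refine ⟨n + m, f * x ^ m + g * x ^ n, add_mem ?_ ?_, ?_⟩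
    · rw [pow_add]; exact Ideal.mul_mem_mul hf (Ideal.pow_mem_pow hx m)
    · rw [add_comm, pow_add]; exact Ideal.mul_mem_mul hg (Ideal.pow_mem_pow hx n)
    · simp only [map_add, map_mul, map_pow, ← ha, ← hb]; ring
  | mul a b _ _ ha hb =>
    obtain ⟨n, f, hf, ha⟩ := ha
    obtain ⟨m, g, hg, hb⟩ := hb
    refine ⟨n + m, f * g, ?_, ?_⟩
    · rw [pow_add]; exact Ideal.mul_mem_mul hf hg
    · simp only [map_mul, ← ha, ← hb]; ring

lemma map_ideal (hx : x ∈ I) :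
    I.map (algebraMap R (blowUpAlgebra I x)) = Ideal.span {algebraMap R _ x} := by
  apply le_antisymm
  · rw [Ideal.map_le_iff_le_comap]
    intro y hy
    obtain ⟨a, ha⟩ := exists_mul_eq (x := x) hy
    exact Ideal.mem_span_singleton'.mpr ⟨a, ha⟩
  · rw [Ideal.span_singleton_le_iff_mem]
    exact Ideal.mem_map_of_mem _ hx

lemma ringHom_ext {C : Type*} [CommRing C] (hx : x ∈ I) {φ ψ : blowUpAlgebra I x →+* C}
    (hreg : φ (algebraMap R _ x) ∈ nonZeroDivisors C)
    (h : φ.comp (algebraMap R _) = ψ.comp (algebraMap R _)) : φ = ψ := by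
  ext a
  obtain ⟨n, f, -, hf⟩ := exists_mul_pow_eq hx a
  have hxx : φ (algebraMap R _ x) = ψ (algebraMap R _ x) := RingHom.congr_fun h x
  have hff : φ (algebraMap R _ f) = ψ (algebraMap R _ f) := RingHom.congr_fun h f
  rw [← hf, map_mul, map_mul, map_pow, map_pow, ← hxx] at hff
  exact (mul_cancel_right_mem_nonZeroDivisors (pow_mem hreg n)).mp hff

/-- The fractions $y/x$ make sense in the localization of $C$ at $\varphi(x)$, into which $C$
embeds. They land in $C$ because $\varphi(x)$ divides the image of every $y\in I$. -/
lemma exists_lift {C : Type*} [CommRing C] (φ : R →+* C) (hreg : φ x ∈ nonZeroDivisors C)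
    (h : I.map φ ≤ Ideal.span {φ x}) :
    ∃ ψ : blowUpAlgebra I x →+* C, ψ.comp (algebraMap R _) = φ := by
  let L := Localization.Away (φ x)
  have hinj : Function.Injective (algebraMap C L) :=
    IsLocalization.injective _ (Submonoid.powers_le.mpr hreg)
  let Φ : Localization.Away x →+* L := IsLocalization.Away.lift (S := Localization.Away x) x
    (g := (algebraMap C L).comp φ) (IsLocalization.Away.algebraMap_isUnit (φ x))
  have hΦ : ∀ r, Φ (algebraMap R _ r) = algebraMap C L (φ r) := fun r ↦
    IsLocalization.Away.lift_eq _ _ r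
  have hmem : ∀ a : blowUpAlgebra I x, Φ a ∈ (algebraMap C L).range := by
    rintro ⟨a, ha⟩
    induction ha using Algebra.adjoin_induction with
    | mem a ha =>
      obtain ⟨y, hy, ha⟩ := ha
      obtain ⟨c, hc⟩ := Ideal.mem_span_singleton'.mp (h (Ideal.mem_map_of_mem φ hy))
      refine ⟨c, ?_⟩
      have hu : IsUnit (algebraMap C L (φ x)) := IsLocalization.Away.algebraMap_isUnit (φ x)
      apply hu.mul_left_inj.mp
      rw [← map_mul, hc, ← hΦ, ← hΦ, ← map_mul, ha]
    | algebraMap r => exact ⟨φ r, (hΦ r).symm⟩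
    | add a b _ _ ha hb => simpa using add_mem ha hb
    | mul a b _ _ ha hb => simpa using mul_mem ha hb
  let e := (RingEquiv.ofBijective (algebraMap C L).rangeRestrict
    ⟨fun a b hab ↦ hinj (congrArg Subtype.val hab), (algebraMap C L).rangeRestrict_surjective⟩)
  refine ⟨e.symm.toRingHom.comp ((Φ.comp (blowUpAlgebra I x).val.toRingHom).codRestrict _ hmem),
    RingHom.ext fun r ↦ ?_⟩
  simp only [RingHom.comp_apply]
  refine (RingEquiv.symm_apply_eq e).mpr (Subtype.ext (hΦ r))

lemma isNoetherianRing [IsNoetherianRing R] : IsNoetherianRing (blowUpAlgebra I x) := by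
  obtain ⟨s, hs⟩ := (isNoetherianRing_iff_ideal_fg R).mp inferInstance I
  obtain ⟨v, hv⟩ := (isUnit_algebraMap (x := x)).exists_left_inv
  suffices h : (blowUpAlgebra I x).FG from
    isNoetherianRing_of_fg h
  classical
  refine ⟨s.image fun y ↦ algebraMap R _ y * v, le_antisymm ?_ ?_⟩
  · refine Algebra.adjoin_le ?_
    intro a ha
    obtain ⟨y, hy, rfl⟩ := Finset.mem_image.mp (Finset.mem_coe.mp ha)
    refine Algebra.subset_adjoin ⟨y, hs ▸ Ideal.subset_span hy, ?_⟩
    rw [mul_assoc, hv, mul_one]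
  · refine Algebra.adjoin_le ?_
    rintro a ⟨y, hy, ha⟩
    have : a = algebraMap R _ y * v := by
      rw [← ha, mul_assoc, mul_comm _ v, hv, mul_one]
    rw [this, SetLike.mem_coe]
    rw [← hs] at hy
    clear ha this
    induction hy using Submodule.span_induction with
    | mem y hy => exact Algebra.subset_adjoin (Finset.mem_coe.mpr (Finset.mem_image_of_mem _ hy))
    | zero => simp
    | add a b _ _ ha hb => rw [map_add, add_mul]; exact add_mem ha hb
    | smul r b _ hb =>
      rw [smul_eq_mul, map_mul, mul_assoc]
      exact mul_mem (Subalgebra.algebraMap_mem _ r) hb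

lemma pow_notMem (hI : IsQuasiRegular I) {K : Ideal R} (hK : I ≤ K) [K.IsPrime] (hx : x ∈ I)
    (hxK : x ∉ K * I) (n : ℕ) : x ^ n ∉ K * I ^ n := by
  induction n with
  | zero => simpa using (Ideal.ne_top_iff_one K).mp (Ideal.IsPrime.ne_top ‹_›)
  | succ n ih =>
    intro h
    rw [pow_succ x] at h
    rcases hI.mem_or_mem K hK ‹_› n 1 _ (Ideal.pow_mem_pow hx n) x (by simpa using hx) h with h | h
    · exact ih h
    · exact hxK (by simpa using h)

variable [IsDomain R]

lemma isDomain (hx : x ≠ 0) : IsDomain (blowUpAlgebra I x) := by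
  have : IsDomain (Localization.Away x) := IsLocalization.isDomain_localization
    (powers_le_nonZeroDivisors_of_noZeroDivisors hx)
  infer_instance

lemma algebraMap_injective (hx : x ≠ 0) :
    Function.Injective (algebraMap R (blowUpAlgebra I x)) := by
  intro a b hab
  exact IsLocalization.injective (Localization.Away x)
    (powers_le_nonZeroDivisors_of_noZeroDivisors hx) (congrArg Subtype.val hab)

/-- The quotient of the algebra by $x$ is the degree zero part of the graded ring of $I$ localized
at the class of $x$. That class is nonzero and the graded ring is a domain, so passing to this
localization loses nothing. -/
lemma mem_span_iff (hI : IsQuasiRegular I) [I.IsPrime] (hx0 : x ≠ 0) (hx : x ∈ I)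
    (hxI : x ∉ I * I) {a : blowUpAlgebra I x} {n : ℕ} {f : R} (hf : f ∈ I ^ n)
    (h : a * algebraMap R _ x ^ n = algebraMap R _ f) :
    a ∈ Ideal.span {algebraMap R (blowUpAlgebra I x) x} ↔ f ∈ I * I ^ n := by
  constructor
  · intro ha
    obtain ⟨b, rfl⟩ := Ideal.mem_span_singleton'.mp ha
    obtain ⟨m, g, hg, hb⟩ := exists_mul_pow_eq hx b
    have e : f * x ^ m = x ^ (n + 1) * g := by
      apply algebraMap_injective (I := I) hx0
      simp only [map_mul, map_pow, ← h, ← hb]; ring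
    have hfx : f * x ^ m ∈ I * I ^ (n + m) := by
      rw [e, ← pow_succ']
      have := Ideal.mul_mem_mul (Ideal.pow_mem_pow hx (n + 1)) hg
      rw [← pow_add] at this
      convert this using 2; omega
    exact (hI.mem_or_mem I le_rfl ‹_› n m f hf _ (Ideal.pow_mem_pow hx m) hfx).resolve_right
      (pow_notMem hI le_rfl hx hxI m)
  · intro hf'
    rw [← pow_succ'] at hf'
    obtain ⟨b, hb⟩ := exists_mul_pow_eq_of_mem (x := x) hf'
    refine Ideal.mem_span_singleton'.mpr ⟨b, mul_pow_left_inj (n := n) ?_⟩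
    rw [h, ← hb]; ring

lemma isPrime_span (hI : IsQuasiRegular I) [I.IsPrime] (hx0 : x ≠ 0) (hx : x ∈ I)
    (hxI : x ∉ I * I) : (Ideal.span {algebraMap R (blowUpAlgebra I x) x}).IsPrime := by
  refine ⟨?_, ?_⟩
  · rw [Ideal.ne_top_iff_one, mem_span_iff hI hx0 hx hxI (n := 0) (f := 1) (by simp) (by simp)]
    simpa using (Ideal.ne_top_iff_one I).mp (Ideal.IsPrime.ne_top ‹_›)
  · intro a b hab
    obtain ⟨m, f, hf, ha⟩ := exists_mul_pow_eq hx a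
    obtain ⟨n, g, hg, hb⟩ := exists_mul_pow_eq hx b
    rw [mem_span_iff hI hx0 hx hxI (n := m + n) (f := f * g)
      (by rw [pow_add]; exact Ideal.mul_mem_mul hf hg)
      (by rw [map_mul, ← ha, ← hb]; ring)] at hab
    rw [mem_span_iff hI hx0 hx hxI hf ha, mem_span_iff hI hx0 hx hxI hg hb]
    exact hI.mem_or_mem I le_rfl ‹_› m n f hf g hg hab

lemma comap_span (hI : IsQuasiRegular I) [I.IsPrime] (hx0 : x ≠ 0) (hx : x ∈ I)
    (hxI : x ∉ I * I) :
    (Ideal.span {algebraMap R (blowUpAlgebra I x) x}).comap (algebraMap R _) = I := by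
  ext r
  rw [Ideal.mem_comap, mem_span_iff hI hx0 hx hxI (n := 0) (f := r) (by simp) (by simp)]
  simp

/-- If $r$ lies in the extension of $p$, clearing denominators gives $rx^n\in pI^n$. Since
$x^n\notin pI^n$, the domain property modulo $p$ forces $r\in p$. This gives surjectivity of the
blow-up onto the center. -/
lemma exists_isPrime_comap_eq (hI : IsQuasiRegular I) (hx0 : x ≠ 0) (hx : x ∈ I)
    {p : Ideal R} [hp : p.IsPrime] (hIp : I ≤ p) (hxp : x ∉ p * I) :
    ∃ q : Ideal (blowUpAlgebra I x), q.IsPrime ∧ q.comap (algebraMap R _) = p := by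
  suffices h : (p.map (algebraMap R (blowUpAlgebra I x))).comap (algebraMap R _) = p from
    (Ideal.comap_map_eq_self_iff_of_isPrime p).mp h
  refine le_antisymm (fun r hr ↦ ?_) Ideal.le_comap_map
  have key : ∀ c ∈ p.map (algebraMap R (blowUpAlgebra I x)), ∃ n, ∃ f ∈ p * I ^ n,
      c * algebraMap R _ x ^ n = algebraMap R _ f := by
    intro c hc
    induction hc using Submodule.span_induction with
    | mem c hc =>
      obtain ⟨y, hy, rfl⟩ := hc
      exact ⟨0, y, by simpa using hy, by simp⟩
    | zero => exact ⟨0, 0, by simp, by simp⟩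
    | add a b _ _ ha hb =>
      obtain ⟨n, f, hf, ha⟩ := ha
      obtain ⟨m, g, hg, hb⟩ := hb
      refine ⟨n + m, f * x ^ m + g * x ^ n, add_mem ?_ ?_, ?_⟩
      · rw [pow_add, ← mul_assoc]; exact Ideal.mul_mem_mul hf (Ideal.pow_mem_pow hx m)
      · rw [add_comm, pow_add, ← mul_assoc]; exact Ideal.mul_mem_mul hg (Ideal.pow_mem_pow hx n)
      · simp only [map_add, map_mul, map_pow, ← ha, ← hb]; ring
    | smul a b _ hb =>
      obtain ⟨n, f, hf, ha⟩ := exists_mul_pow_eq hx a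
      obtain ⟨m, g, hg, hb⟩ := hb
      refine ⟨n + m, f * g, ?_, ?_⟩
      · rw [pow_add, mul_left_comm]; exact Ideal.mul_mem_mul hf hg
      · simp only [map_mul, ← ha, ← hb, smul_eq_mul]; ring
  obtain ⟨n, f, hf, h⟩ := key _ hr
  have e : r * x ^ n = f := by
    apply algebraMap_injective (I := I) hx0
    simpa using h
  rcases hI.mem_or_mem p hIp hp 0 n r (by simp) _ (Ideal.pow_mem_pow hx n)
    (by rwa [e, zero_add]) with h | h
  · simpa using h
  · exact absurd h (pow_notMem hI hIp hx hxp n)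

end blowUpAlgebra

end BlowUpAlgebra

end

/-! ### Inverse images of ideal sheaves on affine opens. -/

section

section IdealSheaf

open Scheme

lemma ideal_comap_of_isOpenImmersion' {X Y : Scheme.{u}} (I : Y.IdealSheafData) (j : X ⟶ Y)
    [IsOpenImmersion j] (W : Y.affineOpens) (V : X.affineOpens) (h : V.1 ≤ j ⁻¹ᵁ W.1) :
    (I.comap j).ideal V = (I.ideal W).map (j.appLE W.1 V.1 h).hom := by
  rw [IdealSheafData.ideal_comap_of_isOpenImmersion]
  have hle : j ''ᵁ V.1 ≤ W.1 := (j.image_mono h).trans (j.image_preimage_le _)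
  rw [← I.map_ideal (V := W) (U := ⟨j ''ᵁ V.1, V.2.image_of_isOpenImmersion j⟩) hle]
  have e : (Ideal.map (Y.presheaf.map (homOfLE hle).op).hom (I.ideal W)).comap
      (j.appIso V.1).inv.hom =
      (Ideal.map (Y.presheaf.map (homOfLE hle).op).hom (I.ideal W)).map
      (j.appIso V.1).hom.hom :=
    (Ideal.map_comap_of_equiv (j.appIso V.1).commRingCatIsoToRingEquiv).symm
  refine e.trans ?_
  rw [Ideal.map_map, ← CommRingCat.hom_comp, Scheme.Hom.appIso_hom', Scheme.Hom.map_appLE]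

/-- Inverse image is left adjoint to direct image, and on affine schemes direct image is contraction
of ideals. Both sides therefore have the same upper bounds. -/
lemma ideal_comap_SpecMap {A B : CommRingCat.{u}} (φ : A ⟶ B) (J : (Spec A).IdealSheafData) :
    (J.comap (Spec.map φ)).ideal ⟨⊤, isAffineOpen_top _⟩ =
      (J.ideal ⟨⊤, isAffineOpen_top _⟩).map (Spec.map φ).appTop.hom := by
  have key : ∀ K : (Spec B).IdealSheafData, J.comap (Spec.map φ) ≤ K ↔
      (J.ideal ⟨⊤, isAffineOpen_top _⟩).map (Spec.map φ).appTop.hom ≤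
        K.ideal ⟨⊤, isAffineOpen_top _⟩ := by
    intro K
    rw [← IdealSheafData.le_map_iff_comap_le, Ideal.map_le_iff_le_comap]
    have := K.ideal_map_of_isAffineHom (Spec.map φ) ⟨⊤, isAffineOpen_top _⟩
    constructor
    · intro h
      exact (h _).trans this.le
    · intro h
      exact IdealSheafData.le_of_isAffine (h.trans this.ge)
  apply le_antisymm
  · have := (key (IdealSheafData.ofIdealTop
      ((J.ideal ⟨⊤, isAffineOpen_top _⟩).map (Spec.map φ).appTop.hom))).mpr (by
        exact (IdealSheafData.equivOfIsAffine.apply_symm_apply _).ge)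
    simpa using this ⟨⊤, isAffineOpen_top _⟩
  · exact (key _).mp le_rfl

lemma ideal_comap_SpecMap_fromSpec {X : Scheme.{u}} (I : X.IdealSheafData) {W : X.Opens}
    (hW : IsAffineOpen W) {B : CommRingCat.{u}} (φ : Γ(X, W) ⟶ B) :
    (I.comap (Spec.map φ ≫ hW.fromSpec)).ideal ⟨⊤, isAffineOpen_top _⟩ =
      ((I.ideal ⟨W, hW⟩).map φ.hom).map (Scheme.ΓSpecIso B).inv.hom := by
  have h : (⊤ : (Spec Γ(X, W)).Opens) ≤ hW.fromSpec ⁻¹ᵁ W := by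
    rw [hW.fromSpec_preimage_self]
  rw [IdealSheafData.comap_comp, ideal_comap_SpecMap,
    ideal_comap_of_isOpenImmersion' I hW.fromSpec ⟨W, hW⟩ _ h, Ideal.map_map, Ideal.map_map,
    ← CommRingCat.hom_comp, ← CommRingCat.hom_comp]
  have : hW.fromSpec.appLE W ⊤ h = (Scheme.ΓSpecIso _).inv := by
    rw [Scheme.Hom.appLE, hW.fromSpec_app_self, Category.assoc, ← Functor.map_comp]
    convert! Category.comp_id _
  rw [this, Scheme.ΓSpecIso_inv_naturality φ]

lemma ideal_comap {X Y : Scheme.{u}} (I : Y.IdealSheafData) (f : X ⟶ Y)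
    {W : Y.Opens} (hW : IsAffineOpen W) {U : X.Opens} (hU : IsAffineOpen U) (h : U ≤ f ⁻¹ᵁ W) :
    (I.comap f).ideal ⟨U, hU⟩ = (I.ideal ⟨W, hW⟩).map (f.appLE W U h).hom := by
  have h1 := ideal_comap_SpecMap_fromSpec I hW (f.appLE W U h)
  have h2 := ideal_comap_SpecMap_fromSpec (I.comap f) hU (𝟙 _)
  rw [hW.SpecMap_appLE_fromSpec f hU h, IdealSheafData.comap_comp] at h1
  rw [Spec.map_id, Category.id_comp, CommRingCat.hom_id, Ideal.map_id] at h2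
  rw [h2] at h1
  let e := (Scheme.ΓSpecIso Γ(X, U)).symm.commRingCatIsoToRingEquiv
  have inj : Function.Injective (Ideal.map (e : Γ(X, U) →+* Γ(Spec Γ(X, U), ⊤))) := by
    intro a b hab
    rw [← Ideal.map_of_equiv (I := a) e, hab, Ideal.map_of_equiv]
  exact inj h1

end IdealSheaf

end

/-! ### Effective Cartier divisors and their division. -/

section

section EffectiveCartier

variable {X : Scheme.{u}}

lemma exists_affineOpens_le {x : X} {O : X.Opens} (hx : x ∈ O) :
    ∃ U : X.affineOpens, x ∈ U.1 ∧ U.1 ≤ O := by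
  obtain ⟨U, hU, hxU, hUO⟩ := exists_isAffineOpen_mem_and_subset hx
  exact ⟨⟨U, hU⟩, hxU, hUO⟩

lemma flat_presheaf_map {U V : X.affineOpens} (h : U ≤ V) :
    (X.presheaf.map (homOfLE (X := X.Opens) h).op).hom.Flat := by
  have := HasRingHomProperty.appLE @Flat (𝟙 X) inferInstance V U h
  rwa [show (𝟙 X : X ⟶ X).appLE V.1 U.1 h = X.presheaf.map (homOfLE (X := X.Opens) h).op by
    simp only [Scheme.Hom.appLE, Scheme.Hom.id_app]; exact Category.id_comp _] at this

/-- The ideal of `I` on the affine open `U` is generated by one nonzerodivisor. -/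
def IsCartierOn (I : X.IdealSheafData) (U : X.affineOpens) : Prop :=
  ∃ f ∈ nonZeroDivisors Γ(X, U.1), I.ideal U = Ideal.span {f}

/-- Restriction between affine opens is flat, so nonzerodivisors remain nonzerodivisors. -/
lemma IsCartierOn.mono {I : X.IdealSheafData} {U V : X.affineOpens} (h : U ≤ V)
    (hV : IsCartierOn I V) : IsCartierOn I U := by
  obtain ⟨f, hf, hI⟩ := hV
  refine ⟨(X.presheaf.map (homOfLE (X := X.Opens) h).op).hom f, ?_, ?_⟩
  · algebraize [(X.presheaf.map (homOfLE (X := X.Opens) h).op).hom]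
    have := flat_presheaf_map h
    have hflat : Module.Flat Γ(X, V.1) Γ(X, U.1) := this
    have hr : IsSMulRegular Γ(X, U.1) f := Module.Flat.isSMulRegular_of_nonZeroDivisors hf
    rw [mem_nonZeroDivisors_iff_right]
    intro z hz
    refine hr (a₁ := z) (a₂ := 0) ?_
    change f • z = f • 0
    rw [smul_zero, Algebra.smul_def, mul_comm]
    exact hz
  · rw [← I.map_ideal h, hI, Ideal.map_span, Set.image_singleton]
    rfl

lemma IsCartierOn.mul {I J : X.IdealSheafData} {U : X.affineOpens}
    (hI : IsCartierOn I U) (hJ : IsCartierOn J U) : IsCartierOn (I * J) U := by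
  obtain ⟨f, hf, hI⟩ := hI
  obtain ⟨g, hg, hJ⟩ := hJ
  refine ⟨f * g, mul_mem hf hg, ?_⟩
  rw [Scheme.IdealSheafData.ideal_mul, Pi.mul_apply, hI, hJ,
    Ideal.span_singleton_mul_span_singleton]

lemma isCartierOn_one (U : X.affineOpens) : IsCartierOn (1 : X.IdealSheafData) U :=
  ⟨1, one_mem _, by simp⟩

lemma IsEffectiveCartier.exists_le {I : X.IdealSheafData} (hI : IsEffectiveCartier I) {x : X}
    {O : X.Opens} (hx : x ∈ O) : ∃ U : X.affineOpens, x ∈ U.1 ∧ U.1 ≤ O ∧ IsCartierOn I U := by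
  obtain ⟨U, hxU, hU⟩ := hI x
  obtain ⟨W, hxW, hW⟩ := exists_affineOpens_le (O := U.1 ⊓ O) ⟨hxU, hx⟩
  exact ⟨W, hxW, hW.trans inf_le_right, IsCartierOn.mono (hW.trans inf_le_left) hU⟩

lemma IsEffectiveCartier.mul {I J : X.IdealSheafData} (hI : IsEffectiveCartier I)
    (hJ : IsEffectiveCartier J) : IsEffectiveCartier (I * J) := by
  intro x
  obtain ⟨U, hxU, hU⟩ := hI x
  obtain ⟨W, hxW, hWU, hW⟩ := hJ.exists_le hxU
  exact ⟨W, hxW, (IsCartierOn.mono hWU hU).mul hW⟩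

lemma isEffectiveCartier_one : IsEffectiveCartier (1 : X.IdealSheafData) := by
  intro x
  obtain ⟨U, hxU, -⟩ := exists_affineOpens_le (O := (⊤ : X.Opens)) (x := x) trivial
  exact ⟨U, hxU, isCartierOn_one U⟩

lemma IsEffectiveCartier.pow {I : X.IdealSheafData} (hI : IsEffectiveCartier I) (n : ℕ) :
    IsEffectiveCartier (I ^ n) := by
  induction n with
  | zero => rw [pow_zero]; exact isEffectiveCartier_one
  | succ n ih => rw [pow_succ]; exact ih.mul hI

lemma IsEffectiveCartier.prod {ι : Type*} (s : Finset ι) {I : ι → X.IdealSheafData}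
    (hI : ∀ i, IsEffectiveCartier (I i)) : IsEffectiveCartier (∏ i ∈ s, I i) := by
  classical
  induction s using Finset.induction_on with
  | empty => rw [Finset.prod_empty]; exact isEffectiveCartier_one
  | insert i s hi ih => rw [Finset.prod_insert hi]; exact (hI i).mul ih

lemma mem_colon_iff {R : Type*} [CommRing R] {C N : Ideal R} {r : R} :
    r ∈ C.colon (N : Set R) ↔ Ideal.span {r} * N ≤ C := by
  rw [Submodule.mem_colon]
  constructor
  · intro h
    rw [Ideal.span_singleton_mul_le_iff]
    exact h
  · intro h s hs
    exact h (Ideal.mul_mem_mul (Ideal.mem_span_singleton_self r) hs)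

/-- Since $N$ is finitely generated, one power of $f$ clears the denominators for all its
generators. -/
lemma map_colon_of_isLocalization {R S : Type*} [CommRing R] [CommRing S] [Algebra R S]
    (f : R) [IsLocalization.Away f S] (C N : Ideal R) (hN : N.FG) :
    (C.colon (N : Set R)).map (algebraMap R S) =
      (C.map (algebraMap R S)).colon (N.map (algebraMap R S) : Set S) := by
  apply le_antisymm
  · rw [Ideal.map_le_iff_le_comap]
    intro r hr
    rw [Ideal.mem_comap, mem_colon_iff]
    rw [mem_colon_iff] at hr
    have := Ideal.map_mono (f := algebraMap R S) hr
    rwa [Ideal.map_mul, Ideal.map_span, Set.image_singleton] at this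
  · intro b hb
    obtain ⟨⟨a, ⟨_, k, rfl⟩⟩, hab⟩ := IsLocalization.surj (Submonoid.powers f) b
    have hab' : b * algebraMap R S (f ^ k) = algebraMap R S a := hab
    obtain ⟨s, rfl⟩ := hN
    have hmem : ∀ n ∈ s, ∃ m, f ^ m * (a * n) ∈ C := by
      intro n hn
      have h1 : algebraMap R S (a * n) ∈ C.map (algebraMap R S) := by
        rw [map_mul, ← hab', mul_right_comm]
        refine Ideal.mul_mem_right _ _ ?_
        exact Submodule.mem_colon.mp hb _ (Ideal.mem_map_of_mem _ (Ideal.subset_span hn))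
      rw [IsLocalization.algebraMap_mem_map_algebraMap_iff (Submonoid.powers f)] at h1
      obtain ⟨_, ⟨m, rfl⟩, hm⟩ := h1
      exact ⟨m, hm⟩
    choose! m hm using hmem
    have hM : f ^ (s.sup m) * a ∈ C.colon (Ideal.span (s : Set R) : Set R) := by
      rw [mem_colon_iff, Ideal.span_singleton_mul_le_iff]
      intro z hz
      induction hz using Submodule.span_induction with
      | mem z hz =>
        have hle : m z ≤ s.sup m := Finset.le_sup (Finset.mem_coe.mp hz)
        obtain ⟨d, hd⟩ := Nat.exists_eq_add_of_le hle
        rw [hd, pow_add, mul_assoc, mul_assoc, mul_left_comm]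
        exact Ideal.mul_mem_left _ _ (hm z hz)
      | zero => simp
      | add x y _ _ hx hy => rw [mul_add]; exact add_mem hx hy
      | smul r x _ hx => rw [smul_eq_mul, mul_left_comm]; exact Ideal.mul_mem_left _ _ hx
    have hu : IsUnit (algebraMap R S (f ^ (s.sup m) * f ^ k)) := by
      rw [← pow_add, map_pow]
      exact (IsLocalization.Away.algebraMap_isUnit f).pow _
    have h2 := Ideal.mem_map_of_mem (algebraMap R S) hM
    rw [map_mul, ← hab', mul_left_comm, ← map_mul, mul_comm] at h2
    exact (Ideal.unit_mul_mem_iff_mem _ hu).mp h2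

/-- The quotient of the ideal sheaf `C` by the ideal sheaf `N`. -/
noncomputable def colonSheaf [IsLocallyNoetherian X] (C N : X.IdealSheafData) :
    X.IdealSheafData where
  ideal U := (C.ideal U).colon (N.ideal U : Set Γ(X, U.1))
  map_ideal_basicOpen U f := by
    rw [← C.map_ideal_basicOpen U f, ← N.map_ideal_basicOpen U f]
    have := U.2.isLocalization_basicOpen f
    have : IsNoetherianRing Γ(X, U.1) := IsLocallyNoetherian.component_noetherian U
    exact map_colon_of_isLocalization f (C.ideal U) (N.ideal U)
      ((isNoetherianRing_iff_ideal_fg _).mp this _)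

/-- Where $N=(n)$ and $C=(nk)$, the ideal quotient is $(k)$. Being independent of the chosen
equations, the local quotients glue. -/
lemma IsEffectiveCartier.exists_mul_eq [IsLocallyNoetherian X] {C N : X.IdealSheafData}
    (hC : IsEffectiveCartier C) (hN : IsEffectiveCartier N) (h : C ≤ N) :
    ∃ D : X.IdealSheafData, IsEffectiveCartier D ∧ D * N = C := by
  have key : ∀ x : X, ∃ U : X.affineOpens, x ∈ U.1 ∧ IsCartierOn (colonSheaf C N) U ∧
      (colonSheaf C N * N).ideal U = C.ideal U := by
    intro x
    obtain ⟨U₀, hxU₀, hU₀⟩ := hC x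
    obtain ⟨U, hxU, hUU₀, n, hn, hNn⟩ := hN.exists_le hxU₀
    obtain ⟨c, hc, hCc⟩ := IsCartierOn.mono hUU₀ hU₀
    have hle := h U
    rw [hCc, hNn, Ideal.span_singleton_le_span_singleton] at hle
    obtain ⟨k, rfl⟩ := hle
    have e : (colonSheaf C N).ideal U = Ideal.span {k} := by
      ext r
      change r ∈ (C.ideal U).colon (N.ideal U : Set Γ(X, U.1)) ↔ _
      rw [mem_colon_iff, hCc, hNn, Ideal.span_singleton_mul_span_singleton,
        Ideal.span_singleton_le_span_singleton, Ideal.mem_span_singleton, mul_comm]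
      constructor
      · rintro ⟨d, hd⟩
        refine ⟨d, (mul_cancel_left_mem_nonZeroDivisors hn).mp ?_⟩
        rw [mul_comm n r, hd, mul_assoc, mul_left_comm]
      · exact fun hkr ↦ mul_dvd_mul_right hkr n
    refine ⟨U, hxU, ⟨k, ?_, e⟩, ?_⟩
    · rw [mem_nonZeroDivisors_iff_right] at hc ⊢
      intro z hz
      exact hc z (by rw [mul_left_comm, hz, mul_zero])
    · rw [Scheme.IdealSheafData.ideal_mul, Pi.mul_apply, e, hNn, hCc,
        Ideal.span_singleton_mul_span_singleton, mul_comm]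
  choose U hxU hU hUe using key
  refine ⟨colonSheaf C N, fun x ↦ ⟨U x, hxU x, hU x⟩, ?_⟩
  refine Scheme.IdealSheafData.ext_of_iSup_eq_top U ?_ hUe
  exact eq_top_iff.mpr fun x _ ↦ TopologicalSpace.Opens.mem_iSup.mpr ⟨x, hxU x⟩

end EffectiveCartier

end

/-! ### Local generators of the exceptional divisor. -/

section

section Charts

lemma mem_basicOpen_iff {X : Scheme.{u}} {U : X.Opens} (hU : IsAffineOpen U) {x : X} (hx : x ∈ U)
    (f : Γ(X, U)) : x ∈ X.basicOpen f ↔ f ∉ (hU.primeIdealOf ⟨x, hx⟩).asIdeal := by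
  have h := hU.fromSpec_primeIdealOf ⟨x, hx⟩
  have h2 : x ∈ X.basicOpen f ↔ hU.primeIdealOf ⟨x, hx⟩ ∈ PrimeSpectrum.basicOpen f := by
    rw [← hU.fromSpec_preimage_basicOpen]
    change _ ↔ hU.fromSpec (hU.primeIdealOf ⟨x, hx⟩) ∈ X.basicOpen f
    rw [h]
  exact h2.trans (PrimeSpectrum.mem_basicOpen _ _)

lemma isEffectiveCartier_comap_SpecMap_fromSpec {X : Scheme.{u}} (I : X.IdealSheafData)
    {W : X.Opens} (hW : IsAffineOpen W) {B : CommRingCat.{u}} (φ : Γ(X, W) ⟶ B) {b : B}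
    (hb : b ∈ nonZeroDivisors B) (h : (I.ideal ⟨W, hW⟩).map φ.hom = Ideal.span {b}) :
    IsEffectiveCartier (I.comap (Spec.map φ ≫ hW.fromSpec)) := by
  intro x
  refine ⟨⟨⊤, isAffineOpen_top _⟩, trivial, (Scheme.ΓSpecIso B).inv.hom b, ?_, ?_⟩
  · let e := (Scheme.ΓSpecIso B).symm.commRingCatIsoToRingEquiv
    change e b ∈ _
    rw [mem_nonZeroDivisors_iff_right] at hb ⊢
    intro y hy
    rw [← e.symm.map_eq_zero_iff]
    apply hb
    rw [← e.symm_apply_apply b, ← map_mul, hy, map_zero]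
  · rw [ideal_comap_SpecMap_fromSpec I hW φ, h, Ideal.map_span, Set.image_singleton]

/-- A form of Nakayama's lemma: if all generators lay in $q\cdot(e)$, cancelling $e$ would give
$1\in q$. -/
lemma exists_notMem_mul_eq {B : Type*} [CommRing B] {e : B} (he : e ∈ nonZeroDivisors B)
    {t : Set B} (h : Ideal.span t = Ideal.span {e}) (q : Ideal B) (hq : q ≠ ⊤) :
    ∃ y ∈ t, ∃ b ∉ q, y = b * e := by
  by_contra! H
  have hle : Ideal.span {e} ≤ q * Ideal.span {e} := by
    conv_lhs => rw [← h]
    refine Ideal.span_le.mpr fun y hy ↦ ?_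
    obtain ⟨b, hb⟩ := Ideal.mem_span_singleton'.mp (h.le (Ideal.subset_span hy))
    have hbq : b ∈ q := by
      by_contra hbq
      exact H y hy b hbq hb.symm
    rw [← hb]
    exact Ideal.mul_mem_mul hbq (Ideal.mem_span_singleton_self e)
  obtain ⟨c, hc, hce⟩ := Ideal.mem_mul_span_singleton.mp (hle (Ideal.mem_span_singleton_self e))
  refine hq ((Ideal.eq_top_iff_one q).mpr ?_)
  have : c = 1 := (mul_cancel_right_mem_nonZeroDivisors he).mp (by rw [hce, one_mul])
  rwa [← this]

/-- One of the given generators of the center is a unit at $z$ times the equation of the exceptional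
divisor. Shrinking to where this factor is invertible, that generator becomes an equation itself. -/
lemma exists_ideal_eq_span_appLE {V V' : Scheme.{u}} {Z : V.IdealSheafData} {σ : V' ⟶ V}
    (hE : IsEffectiveCartier (Z.comap σ)) (z : V') {W : V.Opens} (hW : IsAffineOpen W)
    (hz : σ z ∈ W) {s : Set Γ(V, W)} (hs : Z.ideal ⟨W, hW⟩ = Ideal.span s) :
    ∃ (U : V'.Opens) (_ : IsAffineOpen U) (hUW : U ≤ σ ⁻¹ᵁ W), z ∈ U ∧ ∃ x ∈ s,
      (σ.appLE W U hUW).hom x ∈ nonZeroDivisors Γ(V', U) ∧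
      (Z.ideal ⟨W, hW⟩).map (σ.appLE W U hUW).hom = Ideal.span {(σ.appLE W U hUW).hom x} := by
  obtain ⟨⟨U, hU⟩, hzU, hUW, hcar⟩ := hE.exists_le (O := σ ⁻¹ᵁ W) hz
  have hcar' := hcar
  obtain ⟨e, he, hEe⟩ := hcar
  have hUW' : U ≤ σ ⁻¹ᵁ W := hUW
  have hzU' : z ∈ U := hzU
  rw [ideal_comap Z σ hW hU hUW', hs, Ideal.map_span] at hEe
  obtain ⟨_, ⟨x, hx, rfl⟩, b, hb, hxb⟩ := exists_notMem_mul_eq he hEe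
    (hU.primeIdealOf ⟨z, hzU⟩).asIdeal (Ideal.IsPrime.ne_top inferInstance)
  have hzb : z ∈ V'.basicOpen b := (mem_basicOpen_iff hU hzU b).mpr hb
  have hle : V'.basicOpen b ≤ U := V'.basicOpen_le b
  have hU₂ : IsAffineOpen (V'.basicOpen b) := hU.basicOpen b
  obtain ⟨e', he', hEe'⟩ := hcar'.mono (U := ⟨_, hU₂⟩) hle
  have happ : σ.appLE W (V'.basicOpen b) (hle.trans hUW') =
      σ.appLE W U hUW' ≫ V'.presheaf.map (homOfLE hle).op := by
    rw [Scheme.Hom.appLE_map]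
  have hspan : (Z.ideal ⟨W, hW⟩).map (σ.appLE W (V'.basicOpen b) (hle.trans hUW')).hom =
      Ideal.span {(σ.appLE W (V'.basicOpen b) (hle.trans hUW')).hom x} := by
    have hbu : IsUnit ((V'.presheaf.map (homOfLE hle).op).hom b) := by
      have := hU.isLocalization_basicOpen b
      exact IsLocalization.Away.algebraMap_isUnit (S := Γ(V', V'.basicOpen b)) b
    rw [happ, CommRingCat.hom_comp, ← Ideal.map_map, hs, Ideal.map_span, hEe, Ideal.map_span,
      Set.image_singleton, RingHom.comp_apply, hxb, map_mul]
    exact (Ideal.span_singleton_mul_left_unit hbu _).symm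
  refine ⟨V'.basicOpen b, hU₂, hle.trans hUW', hzb, x, hx, ?_, hspan⟩
  rw [ideal_comap Z σ hW hU₂ (hle.trans hUW'), hspan] at hEe'
  obtain ⟨c, hc⟩ := Ideal.span_singleton_le_span_singleton.mp hEe'.ge
  rw [mem_nonZeroDivisors_iff_right] at he' ⊢
  intro y hy
  apply he'
  rw [hc, ← mul_assoc, hy, zero_mul]

end Charts

end

/-! ### Charts of the blow-up from its universal property. -/

section

section Charts

lemma exists_basicOpen_lift {X : Scheme.{u}} {U : X.Opens} (hU : IsAffineOpen U)
    {A : CommRingCat.{u}}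
    (k : Spec A ⟶ X) (p : PrimeSpectrum A) (hp : k p ∈ U) :
    ∃ g ∉ p.asIdeal, ∃ β : Γ(X, U) ⟶ CommRingCat.of (Localization.Away g),
      Spec.map β ≫ hU.fromSpec =
        Spec.map (CommRingCat.ofHom (algebraMap A (Localization.Away g))) ≫ k := by
  obtain ⟨_, ⟨g, rfl⟩, hpg, hg⟩ :=
    PrimeSpectrum.isTopologicalBasis_basic_opens.exists_subset_of_mem_open
      (show p ∈ ((k ⁻¹ᵁ U : (Spec A).Opens) : Set (Spec A)) from hp) (k ⁻¹ᵁ U).isOpen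
  refine ⟨g, hpg, ?_⟩
  have hrange : Set.range (Spec.map (CommRingCat.ofHom (algebraMap A (Localization.Away g))) ≫ k) ⊆
      Set.range hU.fromSpec := by
    rw [hU.range_fromSpec]
    rintro _ ⟨y, rfl⟩
    rw [Scheme.Hom.comp_apply]
    exact hg ((PrimeSpectrum.localization_away_comap_range (Localization.Away g) g).le ⟨y, rfl⟩)
  refine ⟨Spec.preimage (IsOpenImmersion.lift hU.fromSpec _ hrange), ?_⟩
  rw [Spec.map_preimage, IsOpenImmersion.lift_fac]

/-- In the application $A$ is the blow-up algebra and $B$ the ring of an affine open of the blow-up.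
The maps $A\to B\to A_g\to C=B_{\alpha(g)}$, compatible with the localizations, exhibit $C$ as
$A_g$. -/
lemma injective_and_exists_mul_pow_eq {A B C : Type*} [CommRing A] [IsDomain A] [CommRing B]
    [CommRing C] {α : A →+* B} {r : B →+* C} {g : A} (hg : g ≠ 0)
    (hr : letI := r.toAlgebra; IsLocalization.Away (α g) C)
    {β : B →+* Localization.Away g} {γ : Localization.Away g →+* C}
    (hβα : ∀ c, β (α c) = algebraMap A _ c) (hγ : ∀ c, γ (algebraMap A _ c) = r (α c))
    (hγβ : ∀ b, γ (β b) = r b) :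
    Function.Injective (r.comp α) ∧ ∀ b, ∃ a n, b * (r.comp α) g ^ n = (r.comp α) a := by
  let _ := r.toAlgebra
  have hgpow : Submonoid.powers g ≤ nonZeroDivisors A :=
    powers_le_nonZeroDivisors_of_noZeroDivisors hg
  constructor
  · rw [injective_iff_map_eq_zero]
    intro c hc
    have hc' : algebraMap B C (α c) = 0 := hc
    rw [IsLocalization.map_eq_zero_iff (Submonoid.powers (α g))] at hc'
    obtain ⟨⟨_, n, rfl⟩, hn⟩ := hc'
    have h3 : β (α g ^ n * α c) = 0 := by rw [hn, map_zero]
    rw [map_mul, map_pow, hβα, hβα, ← map_pow, ← map_mul] at h3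
    rw [IsLocalization.to_map_eq_zero_iff _ hgpow] at h3
    exact (mul_eq_zero.mp h3).resolve_left (pow_ne_zero n hg)
  · intro b
    obtain ⟨n, b₀, hb₀⟩ := IsLocalization.Away.surj (α g) b
    obtain ⟨m, c, hc⟩ := IsLocalization.Away.surj g (β b₀)
    have h4 := congrArg γ hc
    rw [map_mul, map_pow, hγ, hγ, hγβ] at h4
    have hb₁ : b * r (α g) ^ n = r b₀ := hb₀
    exact ⟨c, n + m, by rw [RingHom.comp_apply, RingHom.comp_apply, ← h4, ← hb₁]; ring⟩

/-- Locally a blow-up is the spectrum of a localization of an affine blow-up algebra. -/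
lemma IsBlowUp.exists_chart {V V' : Scheme.{u}} [IsIntegral V] {Z : V.IdealSheafData} {σ : V' ⟶ V}
    (hσ : IsBlowUp Z σ) (z : V') {W : V.Opens} (hW : IsAffineOpen W) (hz : σ z ∈ W)
    {s : Set Γ(V, W)} (hs : Z.ideal ⟨W, hW⟩ = Ideal.span s) :
    ∃ (U : V'.Opens) (_ : IsAffineOpen U) (hUW : U ≤ σ ⁻¹ᵁ W), z ∈ U ∧ ∃ x ∈ s, x ≠ 0 ∧
      ∃ ψ : blowUpAlgebra (Z.ideal ⟨W, hW⟩) x →+* Γ(V', U),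
        ψ.comp (algebraMap _ _) = (σ.appLE W U hUW).hom ∧ Function.Injective ψ ∧
        ∃ g, IsUnit (ψ g) ∧ ∀ b, ∃ a n, b * ψ g ^ n = ψ a := by
  obtain ⟨U, hU, hUW, hzU, x, hxs, hreg, hspan⟩ := exists_ideal_eq_span_appLE hσ.cartier z hW hz hs
  have : Nonempty W := ⟨⟨_, hz⟩⟩
  have hxI : x ∈ Z.ideal ⟨W, hW⟩ := hs ▸ Ideal.subset_span hxs
  have hBnt : Nontrivial Γ(V', U) := (hU.primeIdealOf ⟨z, hzU⟩).nontrivial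
  have hx0 : x ≠ 0 := by
    rintro rfl
    rw [map_zero] at hreg
    exact zero_notMem_nonZeroDivisors hreg
  have hAdom := blowUpAlgebra.isDomain (I := Z.ideal ⟨W, hW⟩) hx0
  obtain ⟨α, hα⟩ := blowUpAlgebra.exists_lift (σ.appLE W U hUW).hom hreg hspan.le
  let A := CommRingCat.of (blowUpAlgebra (Z.ideal ⟨W, hW⟩) x)
  let ρ : Γ(V, W) ⟶ A := CommRingCat.ofHom (algebraMap _ _)
  let a : A ⟶ Γ(V', U) := CommRingCat.ofHom α
  have hρa : ρ ≫ a = σ.appLE W U hUW := CommRingCat.hom_ext hα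
  -- Existence in the universal property maps the model chart to the blow-up. Uniqueness then shows
  -- that the open set $U$ is included through this map.
  obtain ⟨k, hk, -⟩ := hσ.lift (Spec A) (Spec.map ρ ≫ hW.fromSpec)
    (isEffectiveCartier_comap_SpecMap_fromSpec Z hW ρ
      blowUpAlgebra.algebraMap_mem_nonZeroDivisors (blowUpAlgebra.map_ideal hxI))
  have hak : Spec.map a ≫ k = hU.fromSpec := by
    obtain ⟨_, -, huniq⟩ := hσ.lift (Spec Γ(V', U)) (hU.fromSpec ≫ σ) (by
      rw [← hW.SpecMap_appLE_fromSpec σ hU hUW]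
      exact isEffectiveCartier_comap_SpecMap_fromSpec Z hW _ hreg hspan)
    refine (huniq _ ?_).trans (huniq _ rfl).symm
    change (Spec.map a ≫ k) ≫ σ = _
    rw [Category.assoc, hk, ← Spec.map_comp_assoc, hρa, hW.SpecMap_appLE_fromSpec σ hU hUW]
  let q : Spec Γ(V', U) := hU.primeIdealOf ⟨z, hzU⟩
  let p : PrimeSpectrum A := Spec.map a q
  have hkp : k p ∈ U := by
    have h1 : (Spec.map a ≫ k) q = z := by
      rw [hak]
      exact hU.fromSpec_primeIdealOf ⟨z, hzU⟩
    have h2 : k p = z := h1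
    rwa [h2]
  -- It is not known that `k` is an open immersion, so an inverse is only sought near `p`, over a
  -- basic open set that `k` sends into $U$.
  obtain ⟨g, hgp, β, hβ⟩ := exists_basicOpen_lift hU k p hkp
  have hg0 : g ≠ 0 := by
    rintro rfl
    exact hgp (zero_mem _)
  have hAdom' : IsDomain A := hAdom
  have hgpow : Submonoid.powers g ≤ nonZeroDivisors A :=
    powers_le_nonZeroDivisors_of_noZeroDivisors hg0
  have hlinj : Function.Injective (algebraMap A (Localization.Away g)) :=
    IsLocalization.injective _ hgpow
  have hdom : IsDomain (Localization.Away g) := IsLocalization.isDomain_localization hgpow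
  let l : A ⟶ CommRingCat.of (Localization.Away g) := CommRingCat.ofHom (algebraMap A _)
  have haβ : a ≫ β = l := by
    apply CommRingCat.hom_ext
    symm
    refine blowUpAlgebra.ringHom_ext (C := Localization.Away g) hxI ?_ ?_
    · refine mem_nonZeroDivisors_of_ne_zero fun h ↦ hx0 ?_
      have h2 : (algebraMap Γ(V, W) A) x = 0 := hlinj (h.trans (map_zero _).symm)
      exact blowUpAlgebra.algebraMap_injective hx0 (h2.trans (map_zero _).symm)
    · have : ρ ≫ l = ρ ≫ a ≫ β := by
        apply Spec.map_injective
        rw [← cancel_mono hW.fromSpec, ← Category.assoc ρ, hρa, Spec.map_comp, Spec.map_comp,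
          Category.assoc, Category.assoc, hW.SpecMap_appLE_fromSpec σ hU hUW, reassoc_of% hβ, hk]
      exact congrArg CommRingCat.Hom.hom this
  have hloc := hU.isLocalization_basicOpen (α g)
  have hle : V'.basicOpen (α g) ≤ U := V'.basicOpen_le _
  let r : Γ(V', U) ⟶ Γ(V', V'.basicOpen (α g)) := V'.presheaf.map (homOfLE hle).op
  have hru : IsUnit (r.hom (α g)) :=
    IsLocalization.Away.algebraMap_isUnit (S := Γ(V', V'.basicOpen (α g))) (α g)
  let γ : Localization.Away g →+* Γ(V', V'.basicOpen (α g)) :=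
    IsLocalization.Away.lift g (g := r.hom.comp α) hru
  have hγ : ∀ c, γ (algebraMap A _ c) = r.hom (α c) := fun c ↦ IsLocalization.Away.lift_eq _ _ c
  have hβγ : β ≫ CommRingCat.ofHom γ = r := by
    apply Spec.map_injective
    have hlγ : l ≫ CommRingCat.ofHom γ = a ≫ r := by
      ext c
      exact hγ c
    rw [← cancel_mono hU.fromSpec, Spec.map_comp, Category.assoc, hβ, ← Spec.map_comp_assoc]
    change Spec.map (l ≫ CommRingCat.ofHom γ) ≫ k = _
    rw [hlγ, Spec.map_comp, Category.assoc, hak]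
  have hβα : ∀ c, β.hom (α c) = algebraMap A (Localization.Away g) c := fun c ↦
    RingHom.congr_fun (congrArg CommRingCat.Hom.hom haβ) c
  have hγβ : ∀ b, γ (β.hom b) = r.hom b := fun b ↦
    RingHom.congr_fun (congrArg CommRingCat.Hom.hom hβγ) b
  obtain ⟨h1, h2⟩ := injective_and_exists_mul_pow_eq hg0 hloc hβα hγ hγβ
  refine ⟨V'.basicOpen (α g), hU.basicOpen _, hle.trans hUW, (mem_basicOpen_iff hU hzU _).mpr hgp,
    x, hxs, hx0, r.hom.comp α, ?_, h1, g, hru, h2⟩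
  rw [RingHom.comp_assoc, hα, ← CommRingCat.hom_comp, Scheme.Hom.appLE_map]

end Charts

end

/-! ### Points of affine opens as primes, and an equation for a point with discrete valuation ring.
-/

section

section Points

variable {X : Scheme.{u}} {U : X.Opens} (hU : IsAffineOpen U)

include hU in
lemma mem_support_iff_le_primeIdealOf (I : X.IdealSheafData) {x : X} (hx : x ∈ U) :
    x ∈ (I.support : Set X) ↔ I.ideal ⟨U, hU⟩ ≤ (hU.primeIdealOf ⟨x, hx⟩).asIdeal := by
  rw [SetLike.mem_coe, Scheme.IdealSheafData.mem_support_iff_of_mem (U := ⟨U, hU⟩) hx,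
    Scheme.mem_zeroLocus_iff]
  constructor
  · intro h f hf
    by_contra hfx
    exact h f hf ((mem_basicOpen_iff hU hx f).mpr hfx)
  · intro h f hf hfx
    exact (mem_basicOpen_iff hU hx f).mp hfx (h hf)

lemma specializes_iff_primeIdealOf_le {x y : X} (hx : x ∈ U) (hy : y ∈ U) :
    y ⤳ x ↔ (hU.primeIdealOf ⟨y, hy⟩).asIdeal ≤ (hU.primeIdealOf ⟨x, hx⟩).asIdeal := by
  rw [PrimeSpectrum.asIdeal_le_asIdeal, PrimeSpectrum.le_iff_specializes]
  have h : y ⤳ x ↔ (⟨y, hy⟩ : U) ⤳ ⟨x, hx⟩ :=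
    (Topology.IsInducing.subtypeVal (t := (U : Set X))).specializes_iff
      (x := ⟨y, hy⟩) (y := ⟨x, hx⟩)
  rw [h]
  exact (hU.isoSpec.hom.homeomorph.isInducing.specializes_iff).symm

lemma exists_primeIdealOf_eq (q : Ideal Γ(X, U)) [hq : q.IsPrime] :
    ∃ y, ∃ hy : y ∈ U, (hU.primeIdealOf ⟨y, hy⟩).asIdeal = q := by
  obtain ⟨⟨y, hy⟩, h⟩ := hU.isoSpec.hom.homeomorph.surjective ⟨q, hq⟩
  refine ⟨y, hy, ?_⟩
  exact congrArg PrimeSpectrum.asIdeal h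

lemma eq_of_primeIdealOf_eq {x y : X} (hx : x ∈ U) (hy : y ∈ U)
    (h : (hU.primeIdealOf ⟨y, hy⟩).asIdeal = (hU.primeIdealOf ⟨x, hx⟩).asIdeal) : y = x :=
  (Specializes.antisymm ((specializes_iff_primeIdealOf_le hU hx hy).mpr h.le)
    ((specializes_iff_primeIdealOf_le hU hy hx).mpr h.ge)).eq

lemma primeIdealOf_apply {Y : Scheme.{u}} {f : X ⟶ Y} {W : Y.Opens} (hW : IsAffineOpen W)
    (hUW : U ≤ f ⁻¹ᵁ W) {x : X} (hx : x ∈ U) :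
    (hW.primeIdealOf ⟨f x, hUW hx⟩).asIdeal =
      (hU.primeIdealOf ⟨x, hx⟩).asIdeal.comap (f.appLE W U hUW).hom :=
  congrArg PrimeSpectrum.asIdeal (hW.comap_primeIdealOf_appLE W U hU hUW hx).symm

/-- The element $t$ is the numerator of a uniformizer. A prime inside $p$ containing $t$ extends to
one containing the uniformizer, hence equals $p$. Elsewhere $t$ may vanish at further primes, which
is why only generizations are compared. -/
lemma exists_eq_iff_mem_of_isDiscreteValuationRing {R S : Type*} [CommRing R] [CommRing S]
    [IsDomain S] [Algebra R S] (p : Ideal R) [p.IsPrime] [IsLocalization.AtPrime S p]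
    [IsDiscreteValuationRing S] :
    ∃ t : R, ∀ q : Ideal R, q.IsPrime → q ≤ p → (q = p ↔ t ∈ q) := by
  obtain ⟨ϖ, hϖ⟩ := IsDiscreteValuationRing.exists_irreducible S
  obtain ⟨⟨t, s⟩, hts⟩ := IsLocalization.surj p.primeCompl ϖ
  have hmax := IsLocalization.AtPrime.under_maximalIdeal S p
  have hsu : IsUnit (algebraMap R S s) := IsLocalization.map_units S s
  refine ⟨t, fun q hq hqp ↦ ⟨?_, fun htq ↦ le_antisymm hqp ?_⟩⟩
  · rintro rfl
    rw [← hmax, Ideal.under_def, Ideal.mem_comap, ← hts, hϖ.maximalIdeal_eq]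
    exact Ideal.mul_mem_right _ _ (Ideal.mem_span_singleton_self ϖ)
  · have hdisj : Disjoint (p.primeCompl : Set R) q :=
      Set.disjoint_left.mpr fun x hx hxq ↦ hx (hqp hxq)
    have hϖq : ϖ ∈ q.map (algebraMap R S) := by
      rw [← Ideal.mul_unit_mem_iff_mem _ hsu, hts]
      exact Ideal.mem_map_of_mem _ htq
    rw [← hmax, ← IsLocalization.under_map_of_isPrime_disjoint p.primeCompl S hq hdisj,
      hϖ.maximalIdeal_eq]
    exact Ideal.comap_mono ((Ideal.span_singleton_le_iff_mem _).mpr hϖq)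

/-- A point whose local ring is a discrete valuation ring is cut out by one function among its
generalizations. -/
lemma exists_eq_iff_mem_primeIdealOf [IsIntegral X] (b : X)
    [IsDiscreteValuationRing (X.presheaf.stalk b)] :
    ∃ (U : X.Opens) (hU : IsAffineOpen U) (t : Γ(X, U)), b ∈ U ∧
      ∀ y (hy : y ∈ U), y ⤳ b → (y = b ↔ t ∈ (hU.primeIdealOf ⟨y, hy⟩).asIdeal) := by
  obtain ⟨⟨U, hU⟩, hb, -⟩ := exists_affineOpens_le (O := (⊤ : X.Opens)) (x := b) trivial
  have hb' : b ∈ U := hb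
  let _ := X.presheaf.algebra_section_stalk ⟨b, hb'⟩
  have hloc : IsLocalization.AtPrime (X.presheaf.stalk b) (hU.primeIdealOf ⟨b, hb'⟩).asIdeal :=
    hU.isLocalization_stalk ⟨b, hb'⟩
  obtain ⟨t, ht⟩ := exists_eq_iff_mem_of_isDiscreteValuationRing (S := X.presheaf.stalk b)
    (hU.primeIdealOf ⟨b, hb'⟩).asIdeal
  refine ⟨U, hU, t, hb', fun y hy hyb ↦ ?_⟩
  rw [← ht _ inferInstance ((specializes_iff_primeIdealOf_le hU hb' hy).mp hyb)]
  exact ⟨by rintro rfl; rfl, eq_of_primeIdealOf_eq hU hb' hy⟩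

end Points

end

/-! ### Height estimates. -/

section

section Height

variable {B : Type*} [CommRing B]

lemma two_le_height_of_lt [IsDomain B] {Q p : Ideal B} [Q.IsPrime] [p.IsPrime]
    (hQ : Q ≠ ⊥) (h : Q < p) :
    2 ≤ p.height := by
  have h1 : 1 ≤ Q.height := by
    rw [Order.one_le_iff_ne_zero, Ne, Ideal.height_eq_zero_iff_eq_bot]
    exact hQ
  have h2 := Ideal.height_add_one_le_of_lt_of_isPrime h
  calc (2 : ℕ∞) = 1 + 1 := by norm_num
    _ ≤ Q.height + 1 := by gcongr
    _ ≤ _ := h2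

lemma three_le_height_of_lt [IsDomain B] {Q P p : Ideal B} [Q.IsPrime] [P.IsPrime] [p.IsPrime]
    (hQ : Q ≠ ⊥) (h : Q < P) (h' : P < p) : 3 ≤ p.height := by
  have h2 := Ideal.height_add_one_le_of_lt_of_isPrime h'
  calc (3 : ℕ∞) = 2 + 1 := by norm_num
    _ ≤ P.height + 1 := by gcongr; exact two_le_height_of_lt hQ h
    _ ≤ _ := h2

lemma height_le_two [IsNoetherianRing B] {e t : B} {p : Ideal B}
    (h : p ∈ (Ideal.span {e, t}).minimalPrimes) : p.height ≤ 2 := by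
  classical
  have := Ideal.height_le_card_of_mem_minimalPrimes_span_finset (s := {e, t}) (p := p)
    (by simpa using h)
  exact this.trans (by exact_mod_cast Finset.card_le_two)

lemma height_le_one_of_lt [IsNoetherianRing B] {e t : B} {p q : Ideal B} [q.IsPrime]
    (h : p ∈ (Ideal.span {e, t}).minimalPrimes) (hq : q < p) : q.height ≤ 1 := by
  have := h.1.1
  have h2 := (Ideal.height_add_one_le_of_lt_of_isPrime hq).trans (height_le_two h)
  rw [show (2 : ℕ∞) = 1 + 1 by norm_num] at h2
  exact (ENat.add_le_add_iff_right ENat.one_ne_top).mp h2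

/-- Primes of height one containing a prime element are generated by it. -/
lemma eq_span_of_mem_of_height_le_one [IsDomain B] {e : B} (he : e ≠ 0) [(Ideal.span {e}).IsPrime]
    {q : Ideal B} [q.IsPrime] (hq : q.height ≤ 1) (heq : e ∈ q) : q = Ideal.span {e} := by
  by_contra hne
  have hlt : Ideal.span {e} < q :=
    lt_of_le_of_ne ((Ideal.span_singleton_le_iff_mem _).mpr heq) (Ne.symm hne)
  have := (two_le_height_of_lt (by simpa using he) hlt).trans hq
  exact absurd this (by norm_num)

/-- A minimal prime of $(h)$ has height at most one, so if it contained the prime element $e$ it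
would be $(e)$, which does not contain $h$. -/
lemma exists_isPrime_le_notMem [IsDomain B] [IsNoetherianRing B] {e h : B} (he : e ≠ 0)
    [(Ideal.span {e}).IsPrime] (hh : h ∉ Ideal.span {e}) {p : Ideal B} [p.IsPrime] (hp : h ∈ p) :
    ∃ q : Ideal B, q.IsPrime ∧ q ≤ p ∧ h ∈ q ∧ e ∉ q := by
  obtain ⟨q, hq, hqp⟩ := Ideal.exists_minimalPrimes_le (J := p) (I := Ideal.span {h})
    ((Ideal.span_singleton_le_iff_mem _).mpr hp)
  have := hq.1.1
  have hhq : h ∈ q := (Ideal.span_singleton_le_iff_mem _).mp hq.1.2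
  refine ⟨q, inferInstance, hqp, hhq, fun heq ↦ hh ?_⟩
  rw [← eq_span_of_mem_of_height_le_one he ?_ heq]
  · exact hhq
  · exact Ideal.height_le_one_of_isPrincipal_of_mem_minimalPrimes _ _ hq

end Height

section WeaklyRegular

/-- A prime ideal containing a weakly regular sequence of length two has height at least two. -/
lemma exists_isPrime_lt_of_isWeaklyRegular {R : Type*} [CommRing R] [IsDomain R]
    [IsNoetherianRing R]
    {rs : List R} (h : RingTheory.Sequence.IsWeaklyRegular R rs) (hl : 2 ≤ rs.length)
    {p : Ideal R} [hp : p.IsPrime] (hrs : Ideal.ofList rs ≤ p) :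
    ∃ Q : Ideal R, Q.IsPrime ∧ Q ≠ ⊥ ∧ Q < p := by
  obtain ⟨x, l, rfl⟩ : ∃ x l, rs = x :: l := List.exists_cons_of_length_pos (by omega)
  obtain ⟨y, l, rfl⟩ : ∃ y l', l = y :: l' :=
    List.exists_cons_of_length_pos (by simpa [Nat.lt_iff_add_one_le] using hl)
  have hxp : x ∈ p := hrs (Ideal.subset_span (by simp))
  have hyp : y ∈ p := hrs (Ideal.subset_span (by simp))
  rw [RingTheory.Sequence.isWeaklyRegular_cons_iff,
    RingTheory.Sequence.isWeaklyRegular_cons_iff] at h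
  have hx0 : x ≠ 0 := by
    rintro rfl
    exact one_ne_zero (h.1 (a₁ := (1 : R)) (a₂ := 0) (by simp))
  obtain ⟨Q, hQ, hQp⟩ := Ideal.exists_minimalPrimes_le (J := p) (I := Ideal.span {x})
    ((Ideal.span_singleton_le_iff_mem _).mpr hxp)
  have hxQ : x ∈ Q := (Ideal.span_singleton_le_iff_mem _).mp hQ.1.2
  refine ⟨Q, hQ.1.1, fun h0 ↦ hx0 (by simpa [h0] using hxQ), lt_of_le_of_ne hQp ?_⟩
  rintro rfl
  have key : ∀ r, (Submodule.Quotient.mk r : QuotSMulTop x R) = 0 ↔ r ∈ Ideal.span {x} := by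
    intro r
    rw [Submodule.Quotient.mk_eq_zero, Submodule.mem_smul_pointwise_iff_exists,
      Ideal.mem_span_singleton']
    simp [mul_comm]
  -- Elements of a minimal prime of $(x)$ are zero divisors modulo $x$, but $y$ is regular there.
  obtain ⟨r, hr, hyr⟩ := Ideal.exists_mul_mem_of_mem_minimalPrimes hQ hyp
  refine hr ((key r).mp (h.2.1 (a₁ := Submodule.Quotient.mk r) (a₂ := 0) ?_))
  change y • _ = y • _
  rw [smul_zero, ← Submodule.Quotient.mk_smul, key]
  exact hyr

end WeaklyRegular

end

/-! ### Localizations of the blow-up algebra. -/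

section

section LocalizedBlowUpAlgebra

variable {R B : Type*} [CommRing R] [CommRing B] {I : Ideal R} {x : R}

/-- `φ : R → B` exhibits `B` as the localization of the affine blow-up algebra `R[I/x]` at one
element. -/
def IsBlowUpChart (I : Ideal R) (x : R) (φ : R →+* B) : Prop :=
  ∃ ψ : blowUpAlgebra I x →+* B, ψ.comp (algebraMap _ _) = φ ∧ Function.Injective ψ ∧
    ∃ g, IsUnit (ψ g) ∧ ∀ b, ∃ a n, b * ψ g ^ n = ψ a

lemma isLocalization_away_of_injective {A : Type*} [CommRing A] {ψ : A →+* B}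
    (hψ : Function.Injective ψ) {g : A} (hg : IsUnit (ψ g))
    (h : ∀ b, ∃ a n, b * ψ g ^ n = ψ a) :
    letI := ψ.toAlgebra
    IsLocalization.Away g B := by
  let _ := ψ.toAlgebra
  refine (isLocalization_iff _ _).mpr ⟨?_, ?_, ?_⟩
  · rintro ⟨_, n, rfl⟩
    change IsUnit (ψ (g ^ n))
    rw [map_pow]
    exact hg.pow n
  · intro b
    obtain ⟨a, n, h⟩ := h b
    refine ⟨⟨a, ⟨g ^ n, n, rfl⟩⟩, ?_⟩
    change b * ψ (g ^ n) = ψ a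
    rw [map_pow, h]
  · intro a b hab
    exact ⟨1, by rw [hψ hab]⟩

namespace IsBlowUpChart

variable {φ : R →+* B} (h : IsBlowUpChart I x φ)

include h

lemma isNoetherianRing [IsNoetherianRing R] : IsNoetherianRing B := by
  obtain ⟨ψ, hψφ, hψ, g, hg, hsurj⟩ := h
  let _ := ψ.toAlgebra
  have := isLocalization_away_of_injective hψ hg hsurj
  have := blowUpAlgebra.isNoetherianRing (I := I) (x := x)
  exact IsLocalization.isNoetherianRing (Submonoid.powers g) B this

lemma map_ideal (hx : x ∈ I) : I.map φ = Ideal.span {φ x} := by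
  obtain ⟨ψ, hψφ, -⟩ := h
  rw [← hψφ, ← Ideal.map_map, blowUpAlgebra.map_ideal hx, Ideal.map_span, Set.image_singleton]
  rfl

/-- Away from the exceptional divisor the denominators $x^n$ are invertible, so elements of $B$ are
fractions of elements of $R$. -/
lemma exists_mul_eq (hx : x ∈ I) {p : Ideal B} [hp : p.IsPrime] (hxp : φ x ∉ p) (b : B) :
    ∃ r s, φ s ∉ p ∧ b * φ s = φ r := by
  obtain ⟨ψ, hψφ, hψ, g, hg, hsurj⟩ := h
  obtain ⟨a, n, hb⟩ := hsurj b
  obtain ⟨m, f, -, hf⟩ := blowUpAlgebra.exists_mul_pow_eq hx a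
  obtain ⟨k, f', -, hf'⟩ := blowUpAlgebra.exists_mul_pow_eq hx g
  have hφ : ∀ r, φ r = ψ (algebraMap R _ r) := fun r ↦ by rw [← hψφ]; rfl
  have h1 := congrArg ψ hf
  have h2 := congrArg ψ hf'
  rw [map_mul, map_pow, ← hφ, ← hφ] at h1 h2
  refine ⟨f * x ^ (k * n), f' ^ n * x ^ m, ?_, ?_⟩
  · rw [map_mul, map_pow, map_pow, ← h2]
    refine hp.mul_notMem (fun hmem ↦ ?_) (fun hmem ↦ hxp (hp.mem_of_pow_mem _ hmem))
    rcases hp.mem_or_mem (hp.mem_of_pow_mem _ hmem) with hmem | hmem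
    · exact hp.ne_top (Ideal.eq_top_of_isUnit_mem _ hmem hg)
    · exact hxp (hp.mem_of_pow_mem _ hmem)
  · simp only [map_mul, map_pow, ← h1, ← h2, ← hb]
    ring

variable [IsDomain R] (hx0 : x ≠ 0)

include hx0

lemma isDomain [Nontrivial B] : IsDomain B := by
  obtain ⟨ψ, hψφ, hψ, g, hg, hsurj⟩ := h
  let _ := ψ.toAlgebra
  have := isLocalization_away_of_injective hψ hg hsurj
  have := blowUpAlgebra.isDomain (I := I) hx0
  have hg0 : g ≠ 0 := by
    rintro rfl
    rw [map_zero] at hg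
    exact not_isUnit_zero hg
  exact IsLocalization.isDomain_of_le_nonZeroDivisors _
    (powers_le_nonZeroDivisors_of_noZeroDivisors hg0)

lemma injective : Function.Injective φ := by
  obtain ⟨ψ, hψφ, hψ, -⟩ := h
  rw [← hψφ]
  exact hψ.comp (blowUpAlgebra.algebraMap_injective hx0)

lemma isPrime_span_and_comap_eq (hx : x ∈ I) [hI : I.IsPrime] (hq : IsQuasiRegular I)
    (hxI : x ∉ I * I) (hxu : ¬ IsUnit (φ x)) :
    (Ideal.span {φ x}).IsPrime ∧ (Ideal.span {φ x}).comap φ = I := by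
  obtain ⟨ψ, hψφ, hψ, g, hg, hsurj⟩ := h
  let _ := ψ.toAlgebra
  have := isLocalization_away_of_injective hψ hg hsurj
  have hp := blowUpAlgebra.isPrime_span hq hx0 hx hxI
  have hc := blowUpAlgebra.comap_span hq hx0 hx hxI
  have hφx : φ x = ψ (algebraMap R _ x) := by rw [← hψφ]; rfl
  have hmap : (Ideal.span {algebraMap R (blowUpAlgebra I x) x}).map (algebraMap _ B) =
      Ideal.span {φ x} := by
    rw [Ideal.map_span, Set.image_singleton, hφx]; rfl
  -- A power of the unit $g$ divisible by $x$ would make $\varphi(x)$ a unit, that is, the chart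
  -- would miss the exceptional divisor.
  have hdisj : Disjoint (Submonoid.powers g : Set (blowUpAlgebra I x))
      (Ideal.span {algebraMap R (blowUpAlgebra I x) x} : Ideal _) := by
    rw [Set.disjoint_left]
    rintro _ ⟨n, rfl⟩ hn
    obtain ⟨c, hc⟩ := Ideal.mem_span_singleton'.mp hn
    have h2 := congrArg ψ hc
    rw [map_mul, ← hφx, map_pow] at h2
    exact hxu (isUnit_of_mul_isUnit_right (h2 ▸ hg.pow n))
  refine ⟨hmap ▸ IsLocalization.isPrime_of_isPrime_disjoint (Submonoid.powers g) B _ hp hdisj, ?_⟩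
  conv_rhs => rw [← hc, ← IsLocalization.under_map_of_isPrime_disjoint
    (Submonoid.powers g) B hp hdisj]
  rw [hmap, Ideal.under_def, Ideal.comap_comap, ← hψφ]
  rfl

/-- Outside of the exceptional divisor the heights of primes are those of their contractions. -/
lemma height_comap (hx : x ∈ I) {p : Ideal B} [hp : p.IsPrime] (hxp : φ x ∉ p) :
    (p.comap φ).height = p.height := by
  have hp' : (p.comap φ).IsPrime := inferInstance
  have : Nontrivial B := PrimeSpectrum.nontrivial ⟨p, hp⟩
  have := h.isDomain hx0
  have hinj := h.injective hx0
  let _ : Algebra R (Localization.AtPrime p) := ((algebraMap B _).comp φ).toAlgebra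
  -- The blow-up is an isomorphism here: $B_p$ is also the local ring of $R$ at the contraction of
  -- $p$.
  have hloc : IsLocalization.AtPrime (Localization.AtPrime p) (p.comap φ) := by
    have hpc : p.primeCompl ≤ nonZeroDivisors B := p.primeCompl_le_nonZeroDivisors
    refine (isLocalization_iff _ _).mpr ⟨?_, ?_, ?_⟩
    · rintro ⟨s, hs⟩
      exact IsLocalization.map_units (M := p.primeCompl) _ ⟨φ s, hs⟩
    · intro z
      obtain ⟨⟨b, t⟩, hz⟩ := IsLocalization.surj p.primeCompl z
      obtain ⟨r₁, s₁, hs₁, h₁⟩ := h.exists_mul_eq hx hxp b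
      obtain ⟨r₂, s₂, hs₂, h₂⟩ := h.exists_mul_eq hx hxp t
      have hr₂ : φ r₂ ∉ p := by
        rw [← h₂]
        exact hp.mul_notMem t.2 hs₂
      refine ⟨⟨r₁ * s₂, ⟨s₁ * r₂, ?_⟩⟩, ?_⟩
      · change φ (s₁ * r₂) ∉ p
        rw [map_mul]
        exact hp.mul_notMem hs₁ hr₂
      · change z * algebraMap B _ (φ (s₁ * r₂)) = algebraMap B _ (φ (r₁ * s₂))
        have hz' : z * algebraMap B _ (t : B) = algebraMap B _ b := hz
        simp only [map_mul, ← h₁, ← h₂, ← hz']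
        ring
    · intro r s hrs
      refine ⟨1, ?_⟩
      rw [hinj (IsLocalization.injective _ hpc hrs)]
  have h1 := IsLocalization.AtPrime.ringKrullDim_eq_height (p.comap φ) (Localization.AtPrime p)
  have h2 := IsLocalization.AtPrime.ringKrullDim_eq_height p (Localization.AtPrime p)
  exact_mod_cast h1.symm.trans h2

end IsBlowUpChart

end LocalizedBlowUpAlgebra

end

/-! ### Irreducible components and branch loci of fibers. -/

section

section Components

/-- In a sober space the irreducible components of a closed set are the closures of its points
without proper generization in the set. -/
lemma mem_componentsIn_iff {α : Type u} [TopologicalSpace α] [QuasiSober α] [T0Space α]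
    {s F : Set α} (hs : IsClosed s) :
    F ∈ componentsIn s ↔ ∃ f ∈ s, F = closure {f} ∧ ∀ y ∈ s, y ⤳ f → y = f := by
  constructor
  · rintro ⟨⟨hF, hFs⟩, hmax⟩
    have hcl : closure F ⊆ F :=
      hmax ⟨hF.closure, closure_minimal hFs hs⟩ subset_closure
    obtain ⟨f, hf⟩ := QuasiSober.sober hF (isClosed_of_closure_subset hcl)
    have hfF : f ∈ F := hf.def ▸ subset_closure rfl
    refine ⟨f, hFs hfF, hf.def.symm, fun y hy hyf ↦ ?_⟩
    have hsub : closure {y} ⊆ F :=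
      hmax ⟨isIrreducible_singleton.closure, closure_minimal (by simpa using hy) hs⟩
        (hf.def.symm.subset.trans
          (closure_minimal (by simpa using hyf.mem_closure) isClosed_closure))
    have hyF : f ⤳ y := by
      rw [specializes_iff_mem_closure, hf.def]
      exact hsub (subset_closure rfl)
    exact (hyf.antisymm hyF).eq
  · rintro ⟨f, hf, rfl, hmin⟩
    refine ⟨⟨isIrreducible_singleton.closure, closure_minimal (by simpa using hf) hs⟩, ?_⟩
    rintro t ⟨ht, hts⟩ hft
    obtain ⟨y, hy⟩ := QuasiSober.sober ht.closure isClosed_closure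
    have hys : y ∈ s := closure_minimal hts hs (hy.def ▸ subset_closure rfl)
    have hyf : y ⤳ f := by
      rw [specializes_iff_mem_closure, hy.def]
      exact subset_closure (hft (subset_closure rfl))
    rw [← hmin y hys hyf, hy.def]
    exact subset_closure

end Components

section BranchLocus

variable {X V W : Scheme.{u}}

lemma geometricFiberCard_pullback_snd (p : X ⟶ V) (i : W ⟶ V) {Ω : Type u} [Field Ω]
    (y : Spec (.of Ω) ⟶ W) :
    geometricFiberCard (pullback.snd p i) y = geometricFiberCard p (y ≫ i) := by
  refine Nat.card_congr ⟨fun x ↦ ⟨x.1 ≫ pullback.fst p i, ?_⟩,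
    fun x ↦ ⟨pullback.lift x.1 y x.2, pullback.lift_snd _ _ _⟩, ?_, ?_⟩
  · rw [Category.assoc, pullback.condition, ← Category.assoc, x.2]
  · rintro ⟨x, hx⟩
    apply Subtype.ext
    apply pullback.hom_ext
    · exact pullback.lift_fst _ _ _
    · exact (pullback.lift_snd _ _ _).trans hx.symm
  · rintro ⟨x, hx⟩
    exact Subtype.ext (pullback.lift_fst _ _ _)

lemma exists_geometric_point (v : V) : ∃ (Ω : Type u) (_ : Field Ω) (_ : IsAlgClosed Ω)
    (y : Spec (.of Ω) ⟶ V), y (IsLocalRing.closedPoint Ω) = v := by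
  refine ⟨AlgebraicClosure (V.residueField v), inferInstance, inferInstance,
    Spec.map (CommRingCat.ofHom (algebraMap (V.residueField v)
      (AlgebraicClosure (V.residueField v)))) ≫ V.fromSpecResidueField v, ?_⟩
  exact (Scheme.Hom.comp_apply _ _ _).trans (Scheme.fromSpecResidueField_apply _ _)

lemma IsDoubleCover.mem_branchLocus_pullback_snd {p : X ⟶ V} {S : Set V} (hp : IsDoubleCover p S)
    (i : W ⟶ V) (w : W) : w ∈ branchLocus (pullback.snd p i) ↔ i w ∈ S := by
  constructor
  · intro hw
    by_contra hS
    -- Membership in the branch locus quantifies over geometric points above `w`; one is needed for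
    -- it to say anything.
    obtain ⟨Ω, _, _, y, hy⟩ := exists_geometric_point w
    have h1 := hw Ω y hy
    have hyi : (y ≫ i) (IsLocalRing.closedPoint Ω) = i w :=
      (Scheme.Hom.comp_apply _ _ _).trans (congrArg i hy)
    rw [geometricFiberCard_pullback_snd,
      hp.fiber_of_notMem Ω (y ≫ i) (fun hmem ↦ hS (hyi ▸ hmem))] at h1
    omega
  · intro hS Ω _ _ y hy
    rw [geometricFiberCard_pullback_snd]
    have hyi : (y ≫ i) (IsLocalRing.closedPoint Ω) = i w :=
      (Scheme.Hom.comp_apply _ _ _).trans (congrArg i hy)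
    exact hp.fiber_of_mem Ω (y ≫ i) (hyi.symm ▸ hS)

lemma IsDoubleCover.fiberBranchLocus_eq {B : Scheme.{u}} {p : X ⟶ V} {S : Set V}
    (hp : IsDoubleCover p S) (π : V ⟶ B) (b : B) :
    fiberBranchLocus p π b = S ∩ π ⁻¹' {b} := by
  have h : branchLocus (pullback.snd p (π.fiberι b)) = π.fiberι b ⁻¹' S :=
    Set.ext fun w ↦ hp.mem_branchLocus_pullback_snd _ w
  rw [fiberBranchLocus, h, Set.image_preimage_eq_inter_range, Scheme.Hom.range_fiberι]

end BranchLocus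

end

/-! ### Integral subschemes, supports of products, and local equations. -/

section

section IntegralSubscheme

variable {X : Scheme.{u}} {I : X.IdealSheafData} [hI : IsIntegral I.subscheme]

include hI in
lemma exists_isGenericPoint_support : ∃ η, IsGenericPoint η (I.support : Set X) := by
  have h : IsIrreducible (I.support : Set X) := by
    rw [← I.range_subschemeι, ← Set.image_univ]
    exact (IrreducibleSpace.isIrreducible_univ _).image _ I.subschemeι.continuous.continuousOn
  exact QuasiSober.sober h I.support.isClosed

include hI in
lemma isPrime_ideal_of_mem {U : X.Opens} (hU : IsAffineOpen U) {x : X} (hx : x ∈ U)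
    (hxI : x ∈ (I.support : Set X)) : (I.ideal ⟨U, hU⟩).IsPrime := by
  have hne : (I.subschemeι ⁻¹ᵁ U : Set I.subscheme).Nonempty := by
    rw [← I.range_subschemeι] at hxI
    obtain ⟨y, rfl⟩ := hxI
    exact ⟨y, hx⟩
  have : Nonempty (I.subschemeι ⁻¹ᵁ U) := hne.to_subtype
  have h := I.ker_subschemeι_app ⟨U, hU⟩
  rw [← h]
  exact RingHom.ker_isPrime _

include hI in
lemma primeIdealOf_genericPoint {U : X.Opens} (hU : IsAffineOpen U) {x : X} (hx : x ∈ U)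
    (hxI : x ∈ (I.support : Set X)) {η : X} (hη : IsGenericPoint η (I.support : Set X)) :
    ∃ hηU : η ∈ U, (hU.primeIdealOf ⟨η, hηU⟩).asIdeal = I.ideal ⟨U, hU⟩ := by
  have hηU : η ∈ U := (hη.specializes hxI).mem_open U.2 hx
  refine ⟨hηU, le_antisymm ?_ ((mem_support_iff_le_primeIdealOf hU I hηU).mp hη.mem)⟩
  have := isPrime_ideal_of_mem hU hx hxI
  obtain ⟨y, hy, hyI⟩ := exists_primeIdealOf_eq hU (I.ideal ⟨U, hU⟩)
  have hyI' : y ∈ (I.support : Set X) := (mem_support_iff_le_primeIdealOf hU I hy).mpr hyI.ge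
  rw [← hyI]
  exact (specializes_iff_primeIdealOf_le hU hy hηU).mp (hη.specializes hyI')

lemma IsGenericPoint.notMem_of_not_subset {α : Type*} [TopologicalSpace α] {S T : Set α} {η : α}
    (hη : IsGenericPoint η S) (hT : IsClosed T) (h : ¬ S ⊆ T) : η ∉ T :=
  fun hmem ↦ h (hη.def ▸ closure_minimal (by simpa using hmem) hT)

end IntegralSubscheme

lemma IsEffectiveCartier.ideal_ne_bot {X : Scheme.{u}} [IsIntegral X] {I : X.IdealSheafData}
    (hI : IsEffectiveCartier I) {U : X.Opens} (hU : IsAffineOpen U) {x : X} (hx : x ∈ U) :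
    I.ideal ⟨U, hU⟩ ≠ ⊥ := by
  intro h
  obtain ⟨W, hxW, hWU, f, hf, hIW⟩ := hI.exists_le hx
  have : Nonempty W.1 := ⟨⟨x, hxW⟩⟩
  have h2 := I.map_ideal (U := W) (V := ⟨U, hU⟩) hWU
  rw [h, Ideal.map_bot, hIW, eq_comm, Ideal.span_singleton_eq_bot] at h2
  exact nonZeroDivisors.ne_zero hf h2

lemma support_comap_eq {X Y : Scheme.{u}} (I : Y.IdealSheafData) (f : X ⟶ Y) :
    ((I.comap f).support : Set X) = f ⁻¹' (I.support : Set Y) := by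
  rw [Scheme.IdealSheafData.support_comap]
  rfl

lemma ideal_finset_prod {X : Scheme.{u}} {ι : Type*} (s : Finset ι) (D : ι → X.IdealSheafData)
    (U : X.affineOpens) : (∏ j ∈ s, D j).ideal U = ∏ j ∈ s, (D j).ideal U := by
  classical
  induction s using Finset.induction_on with
  | empty => simp
  | insert j s hj ih =>
    rw [Finset.prod_insert hj, Finset.prod_insert hj, ← ih]
    rfl

lemma exists_mem_support_of_mem_support_prod {X : Scheme.{u}} {ι : Type*} (s : Finset ι)
    (D : ι → X.IdealSheafData) {x : X} (hx : x ∈ ((∏ j ∈ s, D j).support : Set X)) :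
    ∃ j ∈ s, x ∈ ((D j).support : Set X) := by
  obtain ⟨⟨U, hU⟩, hxU, -⟩ := exists_affineOpens_le (O := (⊤ : X.Opens)) (x := x) trivial
  rw [mem_support_iff_le_primeIdealOf hU _ hxU, ideal_finset_prod, Ideal.IsPrime.prod_le] at hx
  obtain ⟨j, hj, h⟩ := hx
  · exact ⟨j, hj, (mem_support_iff_le_primeIdealOf hU _ hxU).mpr h⟩
  · infer_instance

lemma support_subset_support_prod {X : Scheme.{u}} {ι : Type*} (s : Finset ι)
    (D : ι → X.IdealSheafData) {j : ι} (hj : j ∈ s) :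
    ((D j).support : Set X) ⊆ ((∏ j ∈ s, D j).support : Set X) := by
  intro x hx
  obtain ⟨⟨U, hU⟩, hxU, -⟩ := exists_affineOpens_le (O := (⊤ : X.Opens)) (x := x) trivial
  rw [mem_support_iff_le_primeIdealOf hU _ hxU] at hx ⊢
  rw [ideal_finset_prod]
  exact (Ideal.prod_le_inf.trans (Finset.inf_le hj)).trans hx

/-- The local equation `t` of the special fiber, as far as generizations of a point of the special
fiber are concerned. -/
lemma exists_fiber_equation {B V : Scheme.{u}} [IsIntegral B] (π : V ⟶ B) {b : B}
    [IsDiscreteValuationRing (B.presheaf.stalk b)] {z : V} (hz : π z = b) :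
    ∃ O : V.Opens, z ∈ O ∧ ∀ {W : V.Opens} (hW : IsAffineOpen W), W ≤ O →
      ∃ t : Γ(V, W), ∀ y (hy : y ∈ W), y ⤳ z →
        (π y = b ↔ t ∈ (hW.primeIdealOf ⟨y, hy⟩).asIdeal) := by
  obtain ⟨U, hU, t, hbU, ht⟩ := exists_eq_iff_mem_primeIdealOf (X := B) b
  refine ⟨π ⁻¹ᵁ U, show π z ∈ U from hz ▸ hbU, fun {W} hW hWU ↦ ⟨(π.appLE U W hWU).hom t, ?_⟩⟩
  intro y hy hyz
  have h := ht (π y) (hWU hy) (hz ▸ hyz.map π.continuous)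
  rwa [primeIdealOf_apply hW hU hWU hy, Ideal.mem_comap] at h

/-- Weak regularity survives the flat restriction to a smaller open set and is all that is used
later. -/
lemma IsRegularlyEmbedded.exists_le {V : Scheme.{u}} {Z : V.IdealSheafData} {c : ℕ}
    (hZ : IsRegularlyEmbedded Z c) {I : V.IdealSheafData} (hI : IsEffectiveCartier I)
    {z : V} (hz : z ∈ (Z.support : Set V)) {O : V.Opens} (hzO : z ∈ O) :
    ∃ (W : V.Opens) (hW : IsAffineOpen W), z ∈ W ∧ W ≤ O ∧ ∃ rs : List Γ(V, W), rs.length = c ∧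
      RingTheory.Sequence.IsWeaklyRegular Γ(V, W) rs ∧ Z.ideal ⟨W, hW⟩ = Ideal.ofList rs ∧
      ∃ d, I.ideal ⟨W, hW⟩ = Ideal.span {d} := by
  obtain ⟨U, hzU, rs, hrs, hreg, hZU⟩ := hZ z hz
  obtain ⟨⟨W, hW⟩, hzW, hWU, d, -, hd⟩ := hI.exists_le (O := U.1 ⊓ O) ⟨hzU, hzO⟩
  have hle : (⟨W, hW⟩ : V.affineOpens) ≤ U := hWU.trans inf_le_left
  refine ⟨W, hW, hzW, hWU.trans inf_le_right,
    rs.map (V.presheaf.map (homOfLE (X := V.Opens) hle).op).hom, by rw [List.length_map, hrs], ?_,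
    ?_, d, hd⟩
  · have hfl := flat_presheaf_map hle
    algebraize [(V.presheaf.map (homOfLE (X := V.Opens) hle).op).hom]
    exact hreg.toIsWeaklyRegular.of_flat
  · rw [← Z.map_ideal (U := ⟨W, hW⟩) (V := U) hle, hZU, Ideal.map_ofList]
    rfl

end

/-! ### Pullback of a divisor and its multiplicity along the center. -/

section

variable {V V' : Scheme.{u}} {Z : V.IdealSheafData} {σ : V' ⟶ V}

/-- Symbolic and ordinary powers agree for a quasi-regular prime: an element outside the prime is
regular modulo it, hence modulo its powers, and denominators can be cancelled. -/
lemma VanishesToOrder.ideal_le_pow {C : V.IdealSheafData} {η : V} {a : ℕ}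
    (h : VanishesToOrder C η a) {W : V.Opens} (hW : IsAffineOpen W) (hη : η ∈ W)
    (hq : IsQuasiRegular (hW.primeIdealOf ⟨η, hη⟩).asIdeal) :
    C.ideal ⟨W, hW⟩ ≤ (hW.primeIdealOf ⟨η, hη⟩).asIdeal ^ a := by
  intro r hr
  have h1 := h ⟨W, hW⟩ hη (Ideal.mem_map_of_mem _ hr)
  let _ : Algebra Γ(V, W) (V.presheaf.stalk η) := (V.presheaf.germ W η hη).hom.toAlgebra
  have hloc : IsLocalization.AtPrime (V.presheaf.stalk η) (hW.primeIdealOf ⟨η, hη⟩).asIdeal :=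
    hW.isLocalization_stalk ⟨η, hη⟩
  set p := (hW.primeIdealOf ⟨η, hη⟩).asIdeal
  have h2 : algebraMap Γ(V, W) (V.presheaf.stalk η) r ∈
      (p ^ a).map (algebraMap Γ(V, W) (V.presheaf.stalk η)) := by
    rw [Ideal.map_pow, IsLocalization.AtPrime.map_eq_maximalIdeal p]
    exact h1
  obtain ⟨s, hs, hsr⟩ := (IsLocalization.algebraMap_mem_map_algebraMap_iff p.primeCompl
    (V.presheaf.stalk η) (p ^ a) r).mp h2
  exact hq.mem_pow_of_mul_mem_pow
    (fun r hr ↦ (Ideal.IsPrime.mem_or_mem inferInstance hr).resolve_left hs) a r hsr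

/-- Along the center the order at the generic point controls the whole ideal near each point. Off
the center the ideal of $\mathcal Z$ is locally the unit ideal. -/
lemma comap_le_comap_pow [IsIntegral Z.subscheme] {c a : ℕ} (hZ : IsRegularlyEmbedded Z c)
    {C : V.IdealSheafData} (ha : ∀ η, IsGenericPoint η (Z.support : Set V) → VanishesToOrder C η a)
    (σ : V' ⟶ V) :
    C.comap σ ≤ Z.comap σ ^ a := by
  have key : ∀ z : V', ∃ U : V'.affineOpens, z ∈ U.1 ∧
      (C.comap σ).ideal U ≤ (Z.comap σ ^ a).ideal U := by
    intro z
    have hW : ∃ (W : V.Opens) (hW : IsAffineOpen W), σ z ∈ W ∧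
        C.ideal ⟨W, hW⟩ ≤ Z.ideal ⟨W, hW⟩ ^ a := by
      by_cases hz : σ z ∈ (Z.support : Set V)
      · obtain ⟨W, hW, hzW, -, rs, -, hrs, hZW, -⟩ :=
          hZ.exists_le isEffectiveCartier_one hz (O := ⊤) trivial
        obtain ⟨η, hη⟩ := exists_isGenericPoint_support (I := Z)
        obtain ⟨hηW, hηZ⟩ := primeIdealOf_genericPoint hW hzW hz hη
        refine ⟨W, hW, hzW, ?_⟩
        rw [← hηZ]
        refine (ha η hη).ideal_le_pow hW hηW ?_
        rw [hηZ, hZW]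
        exact (isQuasiRegular_ofList hrs).1
      · obtain ⟨⟨W, hW⟩, hzW, hWZ⟩ := exists_affineOpens_le (x := σ z)
          (O := ⟨(Z.support : Set V)ᶜ, Z.support.isClosed.isOpen_compl⟩) hz
        have htop : Z.ideal ⟨W, hW⟩ = ⊤ := by
          by_contra hne
          obtain ⟨m, hm, hZm⟩ := Ideal.exists_le_maximal _ hne
          obtain ⟨y, hy, rfl⟩ := exists_primeIdealOf_eq hW m
          exact hWZ hy ((mem_support_iff_le_primeIdealOf hW Z hy).mpr hZm)
        refine ⟨W, hW, hzW, ?_⟩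
        rw [htop, Ideal.top_pow]
        exact le_top
    obtain ⟨W, hW, hzW, hle⟩ := hW
    obtain ⟨⟨U, hU⟩, hzU, hUW⟩ := exists_affineOpens_le (O := σ ⁻¹ᵁ W) (x := z) hzW
    refine ⟨⟨U, hU⟩, hzU, ?_⟩
    rw [Scheme.IdealSheafData.ideal_pow, Pi.pow_apply, ideal_comap C σ hW hU hUW,
      ideal_comap Z σ hW hU hUW, ← Ideal.map_pow]
    exact Ideal.map_mono hle
  choose U hzU hU using key
  exact Scheme.IdealSheafData.le_of_iSup_eq_top U
    (top_unique fun z _ ↦ TopologicalSpace.Opens.mem_iSup.mpr ⟨z, hzU z⟩) hU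

variable [IsIntegral V]

lemma IsBlowUp.exists_isBlowUpChart (hσ : IsBlowUp Z σ) (z : V') {W : V.Opens} (hW : IsAffineOpen W)
    (hz : σ z ∈ W) {s : Set Γ(V, W)} (hs : Z.ideal ⟨W, hW⟩ = Ideal.span s) :
    ∃ (U : V'.Opens) (_ : IsAffineOpen U) (hUW : U ≤ σ ⁻¹ᵁ W), z ∈ U ∧ ∃ x ∈ s, x ≠ 0 ∧
      IsBlowUpChart (Z.ideal ⟨W, hW⟩) x (σ.appLE W U hUW).hom :=
  hσ.exists_chart z hW hz hs

lemma IsBlowUp.isLocallyNoetherian [IsLocallyNoetherian V] (hσ : IsBlowUp Z σ) :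
    IsLocallyNoetherian V' := by
  have key : ∀ z : V', ∃ U : V'.affineOpens, z ∈ U.1 ∧ IsNoetherianRing Γ(V', U.1) := by
    intro z
    obtain ⟨⟨W, hW⟩, hzW, -⟩ := exists_affineOpens_le (O := (⊤ : V.Opens)) (x := σ z) trivial
    obtain ⟨U, hU, hUW, hzU, x, -, -, hx⟩ := hσ.exists_isBlowUpChart z hW hzW
      (s := (Z.ideal ⟨W, hW⟩ : Set _)) (Ideal.span_eq _).symm
    have : IsNoetherianRing Γ(V, W) := IsLocallyNoetherian.component_noetherian ⟨W, hW⟩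
    exact ⟨⟨U, hU⟩, hzU, hx.isNoetherianRing⟩
  choose U hzU hU using key
  refine isLocallyNoetherian_of_affine_cover (S := U) ?_ hU
  exact top_unique fun z _ ↦ TopologicalSpace.Opens.mem_iSup.mpr ⟨z, hzU z⟩

/-- The ring of a chart is a domain containing the ring below, so a nonzero equation stays nonzero.
-/
lemma IsBlowUp.isEffectiveCartier_comap (hσ : IsBlowUp Z σ) {I : V.IdealSheafData}
    (hI : IsEffectiveCartier I) : IsEffectiveCartier (I.comap σ) := by
  intro z
  obtain ⟨⟨W, hW⟩, hzW, f, hf, hIf⟩ := hI (σ z)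
  obtain ⟨U, hU, hUW, hzU, x, -, hx0, hx⟩ := hσ.exists_isBlowUpChart z hW hzW
    (s := (Z.ideal ⟨W, hW⟩ : Set _)) (Ideal.span_eq _).symm
  have : Nonempty W := ⟨⟨_, hzW⟩⟩
  have : Nonempty U := ⟨⟨_, hzU⟩⟩
  have := hx.isDomain hx0
  refine ⟨⟨U, hU⟩, hzU, (σ.appLE W U hUW).hom f, ?_, ?_⟩
  · rw [mem_nonZeroDivisors_iff_ne_zero, Ne, map_eq_zero_iff _ (hx.injective hx0)]
    exact nonZeroDivisors.ne_zero hf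
  · rw [ideal_comap I σ hW hU hUW, hIf, Ideal.map_span, Set.image_singleton]

/-- The pullback of a divisor of multiplicity `a` along the center is divisible by the `n`-fold
exceptional divisor for `n ≤ a`. -/
lemma IsBlowUp.exists_mul_eq_comap [IsLocallyNoetherian V] [IsIntegral Z.subscheme]
    (hσ : IsBlowUp Z σ) {c a n : ℕ} (hZ : IsRegularlyEmbedded Z c) {C : V.IdealSheafData}
    (hC : IsEffectiveCartier C) (ha : IsMultiplicity C Z a) (hn : n ≤ a) :
    ∃ D' : V'.IdealSheafData, IsEffectiveCartier D' ∧ D' * Z.comap σ ^ n = C.comap σ := by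
  have := hσ.isLocallyNoetherian
  refine IsEffectiveCartier.exists_mul_eq (hσ.isEffectiveCartier_comap hC) (hσ.cartier.pow n) ?_
  refine (comap_le_comap_pow hZ (fun η hη ↦ (ha η hη).1) σ).trans fun U ↦ ?_
  simp only [Scheme.IdealSheafData.ideal_pow, Pi.pow_apply]
  exact Ideal.pow_le_pow_right hn

end

/-! ### Charts adapted to the center, the divisor and the special fiber. -/

section

/-- A chart of the blow-up `σ` around the point `f`, over an affine open subset on which the
center `Z`, the divisor `I` and the special fiber of `π` are given by explicit equations. -/
structure AdaptedChart {B V V' : Scheme.{u}} (π : V ⟶ B) (b : B) (Z I : V.IdealSheafData) (c : ℕ)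
    (σ : V' ⟶ V) (f : V') where
  /-- the affine open subset of the base -/
  W : V.Opens
  hW : IsAffineOpen W
  mem_W : σ f ∈ W
  /-- the regular sequence generating the ideal of the center -/
  rs : List Γ(V, W)
  length_rs : rs.length = c
  isWeaklyRegular : RingTheory.Sequence.IsWeaklyRegular Γ(V, W) rs
  ideal_center : Z.ideal ⟨W, hW⟩ = Ideal.ofList rs
  /-- the equation of the divisor -/
  d : Γ(V, W)
  ideal_divisor : I.ideal ⟨W, hW⟩ = Ideal.span {d}
  /-- the equation of the special fiber -/
  t : Γ(V, W)
  mem_fiber : ∀ y (hy : y ∈ W), y ⤳ σ f → (π y = b ↔ t ∈ (hW.primeIdealOf ⟨y, hy⟩).asIdeal)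
  /-- the affine open subset of the blow-up -/
  U : V'.Opens
  hU : IsAffineOpen U
  le : U ≤ σ ⁻¹ᵁ W
  mem_U : f ∈ U
  /-- the equation of the exceptional divisor -/
  x : Γ(V, W)
  mem_rs : x ∈ rs
  ne_zero : x ≠ 0
  isBlowUpChart : IsBlowUpChart (Z.ideal ⟨W, hW⟩) x (σ.appLE W U le).hom

variable {B V V' : Scheme.{u}} {π : V ⟶ B} {b : B} {Z I : V.IdealSheafData}
  {c : ℕ} {σ : V' ⟶ V} {f : V'}

lemma IsBlowUp.nonempty_adaptedChart [IsIntegral B] [IsIntegral V]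
    [IsDiscreteValuationRing (B.presheaf.stalk b)] (hσ : IsBlowUp Z σ)
    (hZ : IsRegularlyEmbedded Z c) (hI : IsEffectiveCartier I)
    (hfZ : σ f ∈ (Z.support : Set V)) (hfb : π (σ f) = b) :
    Nonempty (AdaptedChart π b Z I c σ f) := by
  obtain ⟨O, hO, ht⟩ := exists_fiber_equation π hfb
  obtain ⟨W, hW, mem_W, hWO, rs, length_rs, hrs, hZW, d, hd⟩ := hZ.exists_le hI hfZ hO
  obtain ⟨t, ht⟩ := ht hW hWO
  obtain ⟨U, hU, hUW, hfU, x, hx, hx0, hchart⟩ :=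
    hσ.exists_isBlowUpChart f hW mem_W (s := {r | r ∈ rs}) hZW
  exact ⟨⟨W, hW, mem_W, rs, length_rs, hrs, hZW, d, hd, t, ht, U, hU, hUW, hfU, x, hx, hx0,
    hchart⟩⟩

namespace AdaptedChart

variable (χ : AdaptedChart π b Z I c σ f)

/-- The restriction of functions to the chart. -/
noncomputable abbrev φ : Γ(V, χ.W) →+* Γ(V', χ.U) := (σ.appLE χ.W χ.U χ.le).hom

lemma x_mem : χ.x ∈ Z.ideal ⟨χ.W, χ.hW⟩ := by
  rw [χ.ideal_center]
  exact Ideal.subset_span χ.mem_rs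

lemma isNoetherianRing_base [IsLocallyNoetherian V] : IsNoetherianRing Γ(V, χ.W) :=
  IsLocallyNoetherian.component_noetherian ⟨χ.W, χ.hW⟩

lemma isNoetherianRing [IsLocallyNoetherian V] : IsNoetherianRing Γ(V', χ.U) := by
  have := χ.isNoetherianRing_base
  exact χ.isBlowUpChart.isNoetherianRing

lemma isDomain_base [IsIntegral V] : IsDomain Γ(V, χ.W) := by
  have : Nonempty χ.W := ⟨⟨_, χ.mem_W⟩⟩
  infer_instance

lemma isDomain [IsIntegral V] : IsDomain Γ(V', χ.U) := by
  have := χ.isDomain_base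
  have : Nonempty χ.U := ⟨⟨_, χ.mem_U⟩⟩
  exact χ.isBlowUpChart.isDomain χ.ne_zero

lemma ideal_exceptional :
    (Z.comap σ).ideal ⟨χ.U, χ.hU⟩ = Ideal.span {χ.φ χ.x} := by
  rw [ideal_comap Z σ χ.hW χ.hU χ.le]
  exact χ.isBlowUpChart.map_ideal χ.x_mem

lemma mem_exceptional_iff {y : V'} (hy : y ∈ χ.U) :
    y ∈ ((Z.comap σ).support : Set V') ↔
      χ.φ χ.x ∈ (χ.hU.primeIdealOf ⟨y, hy⟩).asIdeal := by
  rw [mem_support_iff_le_primeIdealOf χ.hU _ hy, χ.ideal_exceptional,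
    Ideal.span_singleton_le_iff_mem]

lemma mem_fiber_iff {y : V'} (hy : y ∈ χ.U) (hyf : y ⤳ f) :
    y ∈ (σ ≫ π) ⁻¹' {b} ↔ χ.φ χ.t ∈ (χ.hU.primeIdealOf ⟨y, hy⟩).asIdeal := by
  have h := χ.mem_fiber (σ y) (χ.le hy) (hyf.map σ.continuous)
  rw [primeIdealOf_apply χ.hU χ.hW χ.le hy, Ideal.mem_comap] at h
  rw [← h, Set.mem_preimage, Scheme.Hom.comp_apply, Set.mem_singleton_iff]

lemma mem_of_specializes {y : V'} (hyf : y ⤳ f) : y ∈ χ.U := hyf.mem_open χ.U.2 χ.mem_U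

lemma mem_inter_iff {y : V'} (hy : y ∈ χ.U) (hyf : y ⤳ f) :
    y ∈ ((Z.comap σ).support : Set V') ∩ (σ ≫ π) ⁻¹' {b} ↔
      Ideal.span {χ.φ χ.x, χ.φ χ.t} ≤ (χ.hU.primeIdealOf ⟨y, hy⟩).asIdeal := by
  rw [Set.mem_inter_iff, χ.mem_exceptional_iff hy, χ.mem_fiber_iff hy hyf, Ideal.span_le,
    Set.insert_subset_iff, Set.singleton_subset_iff]
  rfl

include χ in
-- A minimal prime of $(e,t)$ below $f$ gives the generic point of a component. Its generizations
-- are generizations of $f$, where $t$ does detect the fiber.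
lemma exists_minimal (hf : f ∈ ((Z.comap σ).support : Set V') ∩ (σ ≫ π) ⁻¹' {b}) :
    ∃ y ∈ ((Z.comap σ).support : Set V') ∩ (σ ≫ π) ⁻¹' {b},
      ∀ y' ∈ ((Z.comap σ).support : Set V') ∩ (σ ≫ π) ⁻¹' {b}, y' ⤳ y → y' = y := by
  obtain ⟨m, hm, hmf⟩ := Ideal.exists_minimalPrimes_le
    ((χ.mem_inter_iff χ.mem_U specializes_rfl).mp hf)
  have := hm.1.1
  obtain ⟨y, hy, rfl⟩ := exists_primeIdealOf_eq χ.hU m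
  have hyf := (specializes_iff_primeIdealOf_le χ.hU χ.mem_U hy).mpr hmf
  refine ⟨y, (χ.mem_inter_iff hy hyf).mpr hm.1.2, fun y' hy' hy'y ↦ ?_⟩
  have hy'U := χ.mem_of_specializes (hy'y.trans hyf)
  have hle := (specializes_iff_primeIdealOf_le χ.hU hy hy'U).mp hy'y
  exact eq_of_primeIdealOf_eq χ.hU hy hy'U
    (hle.antisymm (hm.2 ⟨inferInstance, (χ.mem_inter_iff hy'U (hy'y.trans hyf)).mp hy'⟩ hle))

lemma mem_minimalPrimes (hf : f ∈ ((Z.comap σ).support : Set V') ∩ (σ ≫ π) ⁻¹' {b})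
    (hmin : ∀ y ∈ ((Z.comap σ).support : Set V') ∩ (σ ≫ π) ⁻¹' {b}, y ⤳ f → y = f) :
    (χ.hU.primeIdealOf ⟨f, χ.mem_U⟩).asIdeal ∈
      (Ideal.span {χ.φ χ.x, χ.φ χ.t}).minimalPrimes := by
  refine ⟨⟨inferInstance, (χ.mem_inter_iff χ.mem_U specializes_rfl).mp hf⟩, ?_⟩
  rintro q ⟨hq, hle⟩ hqf
  obtain ⟨y, hy, rfl⟩ := exists_primeIdealOf_eq χ.hU q
  have hyf := (specializes_iff_primeIdealOf_le χ.hU χ.mem_U hy).mpr hqf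
  obtain rfl := hmin y ((χ.mem_inter_iff hy hyf).mpr hle) hyf
  exact le_rfl

/-- Otherwise the generic point of the subscheme, which is a generization of $\sigma(f)$, would lie
in the special fiber. -/
lemma t_notMem {J : V.IdealSheafData} [IsIntegral J.subscheme] (hb : IsClosed {b})
    (hJ : ¬ (J.support : Set V) ⊆ π ⁻¹' {b}) {y : V} (hyJ : y ∈ (J.support : Set V))
    (hyf : y ⤳ σ f) : χ.t ∉ J.ideal ⟨χ.W, χ.hW⟩ := by
  intro ht
  have hyW : y ∈ χ.W := hyf.mem_open χ.W.2 χ.mem_W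
  obtain ⟨η, hη⟩ := exists_isGenericPoint_support (I := J)
  obtain ⟨hηW, hηZ⟩ := primeIdealOf_genericPoint χ.hW hyW hyJ hη
  refine IsGenericPoint.notMem_of_not_subset hη (hb.preimage π.continuous) hJ ?_
  have := (χ.mem_fiber η hηW ((hη.specializes hyJ).trans hyf)).mpr (hηZ ▸ ht)
  exact this

section Center

variable [hZint : IsIntegral Z.subscheme] (hf : σ f ∈ (Z.support : Set V))

include hZint hf

lemma isPrime_center : (Z.ideal ⟨χ.W, χ.hW⟩).IsPrime := isPrime_ideal_of_mem χ.hW χ.mem_W hf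

/-- As a member of the regular sequence, $x$ is nonzero in $I/I^2$; its image is not a unit because
$f$ lies on the exceptional divisor. -/
lemma isPrime_span_and_comap_eq [IsIntegral V] :
    (Ideal.span {χ.φ χ.x}).IsPrime ∧
      (Ideal.span {χ.φ χ.x}).comap χ.φ = Z.ideal ⟨χ.W, χ.hW⟩ := by
  have := χ.isDomain_base
  have hP := χ.isPrime_center hf
  obtain ⟨hq, hx⟩ := isQuasiRegular_ofList χ.isWeaklyRegular
  rw [← χ.ideal_center] at hq hx
  refine χ.isBlowUpChart.isPrime_span_and_comap_eq χ.ne_zero χ.x_mem hq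
    (hx χ.x χ.mem_rs _ le_rfl hP.ne_top) fun hu ↦ ?_
  have h : f ∈ ((Z.comap σ).support : Set V') := by rwa [support_comap_eq]
  exact Ideal.IsPrime.ne_top inferInstance
    (Ideal.eq_top_of_isUnit_mem _ ((χ.mem_exceptional_iff χ.mem_U).mp h) hu)

lemma d_notMem (hZI : ¬ (Z.support : Set V) ⊆ I.support) : χ.d ∉ Z.ideal ⟨χ.W, χ.hW⟩ := by
  intro hd
  obtain ⟨η, hη⟩ := exists_isGenericPoint_support (I := Z)
  obtain ⟨hηW, hηZ⟩ := primeIdealOf_genericPoint χ.hW χ.mem_W hf hη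
  refine IsGenericPoint.notMem_of_not_subset hη I.support.isClosed hZI ?_
  rw [mem_support_iff_le_primeIdealOf χ.hW _ hηW, χ.ideal_divisor, hηZ]
  exact (Ideal.span_singleton_le_iff_mem _).mpr hd

end Center

end AdaptedChart

end

/-! ### The codimension arguments and the theorem. -/

section

lemma mem_of_mul_pow_mem_span_singleton {A : Type*} [CommRing A] [IsDomain A] {e h k : A}
    (he : e ≠ 0) [(Ideal.span {e}).IsPrime] (hh : h ∉ Ideal.span {e}) {n : ℕ}
    (hk : k * e ^ n ∈ Ideal.span {h}) : k ∈ Ideal.span {h} := by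
  induction n with
  | zero => simpa using hk
  | succ n ih =>
    obtain ⟨r, hr⟩ := Ideal.mem_span_singleton'.mp hk
    have hre : r * h ∈ Ideal.span {e} := by
      rw [hr, pow_succ, ← mul_assoc]
      exact Ideal.mul_mem_left _ _ (Ideal.mem_span_singleton_self e)
    obtain ⟨s, rfl⟩ := Ideal.mem_span_singleton'.mp
      ((Ideal.IsPrime.mem_or_mem inferInstance hre).resolve_right hh)
    refine ih (Ideal.mem_span_singleton'.mpr ⟨s, mul_right_cancel₀ he ?_⟩)
    linear_combination hr

namespace AdaptedChart

variable {B V V' : Scheme.{u}} {π : V ⟶ B} {b : B} {Z I : V.IdealSheafData}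
  {c : ℕ} {σ : V' ⟶ V} {f : V'} (χ : AdaptedChart π b Z I c σ f)

lemma φ_d_mem (hfI : σ f ∈ (I.support : Set V)) :
    χ.φ χ.d ∈ (χ.hU.primeIdealOf ⟨f, χ.mem_U⟩).asIdeal := by
  rw [mem_support_iff_le_primeIdealOf χ.hW _ χ.mem_W, χ.ideal_divisor,
    Ideal.span_singleton_le_iff_mem, primeIdealOf_apply χ.hU χ.hW χ.le χ.mem_U] at hfI
  exact hfI

variable [IsIntegral V]

lemma φ_x_ne_zero : χ.φ χ.x ≠ 0 := by
  have := χ.isDomain_base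
  rw [Ne, map_eq_zero_iff _ (χ.isBlowUpChart.injective χ.ne_zero)]
  exact χ.ne_zero

include χ in
-- Such a $y$ cannot lie on $\mathcal E$ unless it is $f$. Off $\mathcal E$, a proper generization
-- of $f$ has height at most 1, and so does its image; but the image strictly specializes the
-- generic point of some $\mathcal D_j$, itself of positive height.
lemma eq_of_specializes_of_mem_support [IsLocallyNoetherian V] {ι : Type*} [Fintype ι]
    {D : ι → V.IdealSheafData} (hDcartier : ∀ j, IsEffectiveCartier (D j))
    (hDprime : ∀ j, IsIntegral (D j).subscheme)
    (hDfiber : ∀ j, ¬ ((D j).support : Set V) ⊆ π ⁻¹' {b}) (hb : IsClosed {b})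
    {D' : V'.IdealSheafData} (hD' : (∏ j, D j).comap σ ≤ D')
    (hf : f ∈ ((Z.comap σ).support : Set V') ∩ (σ ≫ π) ⁻¹' {b})
    (hmin : ∀ y ∈ ((Z.comap σ).support : Set V') ∩ (σ ≫ π) ⁻¹' {b}, y ⤳ f → y = f)
    {y : V'} (hyD' : y ∈ (D'.support : Set V')) (hyb : y ∈ (σ ≫ π) ⁻¹' {b}) (hyf : y ⤳ f) :
    y = f := by
  have := χ.isDomain
  have := χ.isDomain_base
  have := χ.isNoetherianRing
  have hy := χ.mem_of_specializes hyf
  by_cases hyE : y ∈ ((Z.comap σ).support : Set V')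
  · exact hmin y ⟨hyE, hyb⟩ hyf
  have hyx := (χ.mem_exceptional_iff hy).not.mp hyE
  by_contra hne
  have hlt : (χ.hU.primeIdealOf ⟨y, hy⟩).asIdeal < (χ.hU.primeIdealOf ⟨f, χ.mem_U⟩).asIdeal :=
    lt_of_le_of_ne ((specializes_iff_primeIdealOf_le χ.hU χ.mem_U hy).mp hyf)
      fun h ↦ hne (eq_of_primeIdealOf_eq χ.hU χ.mem_U hy h)
  have hht := height_le_one_of_lt (χ.mem_minimalPrimes hf hmin) hlt
  rw [← χ.isBlowUpChart.height_comap χ.ne_zero χ.x_mem hyx,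
    ← primeIdealOf_apply χ.hU χ.hW χ.le hy] at hht
  have hyC : σ y ∈ ((∏ j, D j).support : Set V) := by
    have : y ∈ (((∏ j, D j).comap σ).support : Set V') :=
      Scheme.IdealSheafData.support_antitone hD' hyD'
    rwa [support_comap_eq] at this
  obtain ⟨j, -, hyj⟩ := exists_mem_support_of_mem_support_prod _ _ hyC
  have := hDprime j
  have hyσ := hyf.map σ.continuous
  have hP := isPrime_ideal_of_mem χ.hW (χ.le hy) hyj
  have hlt' : (D j).ideal ⟨χ.W, χ.hW⟩ < (χ.hW.primeIdealOf ⟨σ y, χ.le hy⟩).asIdeal := by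
    refine lt_of_le_of_ne ((mem_support_iff_le_primeIdealOf χ.hW _ (χ.le hy)).mp hyj) fun h ↦ ?_
    refine χ.t_notMem hb (hDfiber j) hyj hyσ ?_
    rw [h, ← χ.mem_fiber _ (χ.le hy) hyσ]
    exact hyb
  have := (two_le_height_of_lt ((hDcartier j).ideal_ne_bot χ.hW χ.mem_W) hlt').trans hht
  exact absurd this (by norm_num)

variable [IsIntegral Z.subscheme]

lemma φ_d_notMem (hf : σ f ∈ (Z.support : Set V)) (hZI : ¬ (Z.support : Set V) ⊆ I.support) :
    χ.φ χ.d ∉ Ideal.span {χ.φ χ.x} := by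
  intro h
  have := χ.d_notMem hf hZI
  rw [← (χ.isPrime_span_and_comap_eq hf).2] at this
  exact this h

include χ in
/-- Subtracting multiples of the exceptional divisor does not remove from the support the points
over a component which does not contain the center. -/
lemma mem_support_of_mul_pow_eq {C : V.IdealSheafData} {D' : V'.IdealSheafData} {n : ℕ}
    (hD' : D' * Z.comap σ ^ n = C.comap σ) (hCI : C ≤ I)
    (hf : σ f ∈ (Z.support : Set V)) (hfI : σ f ∈ (I.support : Set V))
    (hZI : ¬ (Z.support : Set V) ⊆ I.support) : f ∈ (D'.support : Set V') := by
  have := χ.isDomain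
  have hp := (χ.isPrime_span_and_comap_eq hf).1
  rw [mem_support_iff_le_primeIdealOf χ.hU _ χ.mem_U]
  intro k hk
  have h1 : k * χ.φ χ.x ^ n ∈ (D' * Z.comap σ ^ n).ideal ⟨χ.U, χ.hU⟩ := by
    simp only [Scheme.IdealSheafData.ideal_mul, Scheme.IdealSheafData.ideal_pow, Pi.mul_apply,
      Pi.pow_apply]
    refine Ideal.mul_mem_mul hk (Ideal.pow_mem_pow ?_ n)
    rw [χ.ideal_exceptional]
    exact Ideal.mem_span_singleton_self _
  rw [hD', ideal_comap C σ χ.hW χ.hU χ.le] at h1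
  have h2 := Ideal.map_mono (hCI ⟨χ.W, χ.hW⟩) h1
  rw [χ.ideal_divisor, Ideal.map_span, Set.image_singleton] at h2
  have h3 := mem_of_mul_pow_mem_span_singleton χ.φ_x_ne_zero (χ.φ_d_notMem hf hZI) h2
  exact (Ideal.span_singleton_le_iff_mem _).mpr (χ.φ_d_mem hfI) h3

include χ in
-- Some branch of $\{d=0\}$ through $f$ is not contained in $\mathcal E$; its generic point lies
-- over $\mathcal D_i\setminus\mathcal Z$ and specializes to $f$.
lemma mem_strictTransform [IsLocallyNoetherian V] (hf : σ f ∈ (Z.support : Set V))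
    (hfI : σ f ∈ (I.support : Set V)) (hZI : ¬ (Z.support : Set V) ⊆ I.support) :
    f ∈ strictTransform Z σ I.support := by
  have := χ.isDomain
  have := χ.isNoetherianRing
  have hp := (χ.isPrime_span_and_comap_eq hf).1
  obtain ⟨q, hq, hqf, hdq, hxq⟩ :=
    exists_isPrime_le_notMem χ.φ_x_ne_zero (χ.φ_d_notMem hf hZI) (χ.φ_d_mem hfI)
  obtain ⟨y, hy, rfl⟩ := exists_primeIdealOf_eq χ.hU q
  have hyf := (specializes_iff_primeIdealOf_le χ.hU χ.mem_U hy).mpr hqf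
  rw [← χ.mem_exceptional_iff hy, support_comap_eq] at hxq
  refine closure_mono (Set.singleton_subset_iff.mpr ?_) hyf.mem_closure
  refine ⟨?_, hxq⟩
  rw [mem_support_iff_le_primeIdealOf χ.hW _ (χ.le hy), χ.ideal_divisor,
    Ideal.span_singleton_le_iff_mem, primeIdealOf_apply χ.hU χ.hW χ.le hy]
  exact hdq

include χ in
/-- The image of a point of the exceptional divisor is not the generic point of a component of the
special fiber of a divisor, as its codimension is too large. -/
lemma exists_specializes_ne [IsLocallyNoetherian V] (hc : 2 ≤ c) (hb : IsClosed {b})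
    (hZfiber : ¬ (Z.support : Set V) ⊆ π ⁻¹' {b}) (hf : σ f ∈ (Z.support : Set V))
    (hfb : π (σ f) = b) (hfI : σ f ∈ (I.support : Set V)) :
    ∃ y ∈ (I.support : Set V) ∩ π ⁻¹' {b}, y ⤳ σ f ∧ y ≠ σ f := by
  have := χ.isDomain_base
  have := χ.isNoetherianRing_base
  have hP := χ.isPrime_center hf
  have ht : χ.t ∈ (χ.hW.primeIdealOf ⟨σ f, χ.mem_W⟩).asIdeal :=
    (χ.mem_fiber _ χ.mem_W specializes_rfl).mp hfb
  have hd : χ.d ∈ (χ.hW.primeIdealOf ⟨σ f, χ.mem_W⟩).asIdeal := by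
    rwa [mem_support_iff_le_primeIdealOf χ.hW _ χ.mem_W, χ.ideal_divisor,
      Ideal.span_singleton_le_iff_mem] at hfI
  have hlt : Z.ideal ⟨χ.W, χ.hW⟩ < (χ.hW.primeIdealOf ⟨σ f, χ.mem_W⟩).asIdeal := by
    refine lt_of_le_of_ne ((mem_support_iff_le_primeIdealOf χ.hW _ χ.mem_W).mp hf) fun h ↦ ?_
    exact χ.t_notMem hb hZfiber hf specializes_rfl (h ▸ ht)
  -- The chain $0\subset Q\subset I_{\mathcal Z}\subset\mathfrak p_{\sigma(f)}$ is strict, so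
  -- $\sigma(f)$ has height at least 3 and cannot be minimal over $(d,t)$.
  obtain ⟨Q, hQ, hQ0, hQP⟩ := exists_isPrime_lt_of_isWeaklyRegular χ.isWeaklyRegular
    (χ.length_rs.symm ▸ hc) χ.ideal_center.ge
  have hht := three_le_height_of_lt hQ0 hQP hlt
  obtain ⟨m, hm, hmf⟩ := Ideal.exists_minimalPrimes_le (I := Ideal.span {χ.d, χ.t})
    (J := (χ.hW.primeIdealOf ⟨σ f, χ.mem_W⟩).asIdeal)
    (Ideal.span_le.mpr (Set.insert_subset hd (Set.singleton_subset_iff.mpr ht)))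
  have hm' := hm.1.1
  obtain ⟨y, hy, rfl⟩ := exists_primeIdealOf_eq χ.hW m
  have hyf := (specializes_iff_primeIdealOf_le χ.hW χ.mem_W hy).mpr hmf
  refine ⟨y, ⟨?_, ?_⟩, hyf, ?_⟩
  · rw [mem_support_iff_le_primeIdealOf χ.hW _ hy, χ.ideal_divisor,
      Ideal.span_singleton_le_iff_mem]
    exact hm.1.2 (Ideal.subset_span (by simp))
  · exact (χ.mem_fiber y hy hyf).mpr (hm.1.2 (Ideal.subset_span (by simp)))
  · rintro rfl
    exact absurd (hht.trans (height_le_two hm)) (by norm_num)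

end AdaptedChart

/-- The blow-up maps onto the center. -/
lemma IsBlowUp.exists_apply_eq {V V' : Scheme.{u}} [IsIntegral V]
    {Z : V.IdealSheafData} {c : ℕ} {σ : V' ⟶ V} (hσ : IsBlowUp Z σ) (hc : 1 ≤ c)
    (hZ : IsRegularlyEmbedded Z c) {z : V} (hz : z ∈ (Z.support : Set V)) : ∃ z', σ z' = z := by
  obtain ⟨W, hW, hzW, -, rs, hl, hrs, hZW, -⟩ :=
    hZ.exists_le isEffectiveCartier_one hz (O := ⊤) trivial
  have : Nonempty W := ⟨⟨_, hzW⟩⟩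
  obtain ⟨x, l, rfl⟩ : ∃ x l, rs = x :: l := List.exists_cons_of_length_pos (by omega)
  obtain ⟨hq, hx⟩ := isQuasiRegular_ofList hrs
  have hle := (mem_support_iff_le_primeIdealOf hW Z hzW).mp hz
  rw [← hZW] at hq hx
  have hxp := hx x (by simp) _ hle (Ideal.IsPrime.ne_top inferInstance)
  have hxZ : x ∈ Z.ideal ⟨W, hW⟩ := by
    rw [hZW]
    exact Ideal.subset_span (by simp)
  have hx0 : x ≠ 0 := by
    rintro rfl
    exact hxp (zero_mem _)
  obtain ⟨q, hqp, hqz⟩ := blowUpAlgebra.exists_isPrime_comap_eq hq hx0 hxZ hle hxp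
  let A := CommRingCat.of (blowUpAlgebra (Z.ideal ⟨W, hW⟩) x)
  let k : Γ(V, W) ⟶ A := CommRingCat.ofHom (algebraMap _ _)
  obtain ⟨g, hg, -⟩ := hσ.lift (Spec A) (Spec.map k ≫ hW.fromSpec)
    (isEffectiveCartier_comap_SpecMap_fromSpec Z hW k
      blowUpAlgebra.algebraMap_mem_nonZeroDivisors (blowUpAlgebra.map_ideal hxZ))
  let y : Spec A := ⟨q, hqp⟩
  have hy : Spec.map k y = hW.primeIdealOf ⟨z, hzW⟩ := PrimeSpectrum.ext hqz
  refine ⟨g y, ?_⟩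
  rw [← Scheme.Hom.comp_apply, hg, Scheme.Hom.comp_apply, hy]
  exact hW.fromSpec_primeIdealOf ⟨z, hzW⟩

end

end JumpingMultiplicity

open JumpingMultiplicity
theorem mainTheorem4
    -- the family `π : V ⟶ B` of ambient spaces and the special point `b`
    {B V : Scheme.{u}} [IsIntegral B] [IsIntegral V] [IsLocallyNoetherian V]
    (π : V ⟶ B) (b : B) (hb : IsClosed {b})
    (hdvr : IsDiscreteValuationRing (B.presheaf.stalk b))
    -- the components of the branch divisor
    {ι : Type*} [Fintype ι] (D : ι → V.IdealSheafData) (hDinj : Function.Injective D)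
    (hDcartier : ∀ j, IsEffectiveCartier (D j))
    (hDprime : ∀ j, IsIntegral (D j).subscheme)
    (hDfiber : ∀ j, ¬ ((D j).support : Set V) ⊆ π ⁻¹' {b})
    -- the center
    (Z : V.IdealSheafData) (hZint : IsIntegral Z.subscheme)
    (c : ℕ) (hc : 2 ≤ c) (hZreg : IsRegularlyEmbedded Z c)
    (hZfiber : ¬ (Z.support : Set V) ⊆ π ⁻¹' {b})
    (hZne : ((Z.support : Set V) ∩ π ⁻¹' {b}).Nonempty)
    -- the multiplicity of the branch divisor along the center
    (a : ℕ) (ha : IsMultiplicity (∏ j, D j) Z a)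
    -- the blow-up
    {V' : Scheme.{u}} (σ : V' ⟶ V) (hσ : IsBlowUp Z σ)
    -- a component which contains the special fiber of the center, but not the center
    (i : ι) (hZi₀ : (Z.support : Set V) ∩ π ⁻¹' {b} ⊆ (D i).support)
    (hZi : ¬ (Z.support : Set V) ⊆ (D i).support) :
    -- the new branch divisor `D' = σ^* D - 2 ⌊a / 2⌋ E` is effective
    ∃ D' : V'.IdealSheafData, IsEffectiveCartier D' ∧
      D' * (Z.comap σ) ^ (2 * (a / 2)) = (∏ j, D j).comap σ ∧
      -- the exceptional divisor has components in the special fiber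
      (componentsIn (((Z.comap σ).support : Set V') ∩ (σ ≫ π) ⁻¹' {b})).Nonempty ∧
      ∀ F ∈ componentsIn (((Z.comap σ).support : Set V') ∩ (σ ≫ π) ⁻¹' {b}),
        -- each is a component of the restriction of `D'` to the special fiber,
        F ∈ componentsIn ((D'.support : Set V') ∩ (σ ≫ π) ⁻¹' {b}) ∧
        -- does not lie over a component of the restriction of `D` to the special fiber,
        closure (σ '' F) ∉
          componentsIn (((∏ j, D j).support : Set V) ∩ π ⁻¹' {b}) ∧
        -- and lies in the strict transform of `D i`;
        F ⊆ strictTransform Z σ (D i).support ∧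
        -- so it is a new component of the branch locus of the special fiber of the double covers
        (∀ (X' : Scheme.{u}) (p' : X' ⟶ V'), IsDoubleCover p' (D'.support : Set V') →
          F ∈ componentsIn (fiberBranchLocus p' (σ ≫ π) b)) ∧
        (∀ (X : Scheme.{u}) (p : X ⟶ V), IsDoubleCover p ((∏ j, D j).support : Set V) →
          closure (σ '' F) ∉ componentsIn (fiberBranchLocus p π b)) := by
  classical
  have := hZint
  have hCi : ∏ j, D j ≤ D i := fun U ↦ by
    rw [ideal_finset_prod]
    exact Ideal.prod_le_inf.trans (Finset.inf_le (Finset.mem_univ i))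
  have hE : ∀ f ∈ ((Z.comap σ).support : Set V') ∩ (σ ≫ π) ⁻¹' {b},
      σ f ∈ (Z.support : Set V) ∧ π (σ f) = b := fun f hf ↦
    ⟨by simpa only [support_comap_eq] using! hf.1,
      (Scheme.Hom.comp_apply σ π f).symm.trans hf.2⟩
  have hclosed : ∀ J : V'.IdealSheafData,
      IsClosed ((J.support : Set V') ∩ (σ ≫ π) ⁻¹' {b}) := fun J ↦
    J.support.isClosed.inter (hb.preimage (σ ≫ π).continuous)
  -- Only $2\lfloor a/2\rfloor\le a$ matters here; the parity plays no role.
  obtain ⟨D', hD'cartier, hD'⟩ := hσ.exists_mul_eq_comap hZreg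
    (IsEffectiveCartier.prod Finset.univ hDcartier) ha (n := 2 * (a / 2)) (by omega)
  refine ⟨D', hD'cartier, hD', ?_, ?_⟩
  -- The blow-up is surjective over the center; a point above $\mathcal Z\cap V_0$ is replaced by a
  -- minimal generization in $\mathcal E\cap\widetilde V_0$.
  · obtain ⟨z, hzZ, hzb⟩ := hZne
    obtain ⟨f, rfl⟩ := hσ.exists_apply_eq (by omega) hZreg hzZ
    obtain ⟨χ⟩ := hσ.nonempty_adaptedChart (π := π) hZreg (hDcartier i) hzZ hzb
    obtain ⟨y, hy, hmin⟩ := χ.exists_minimal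
      ⟨by simpa only [support_comap_eq] using! hzZ, (Scheme.Hom.comp_apply σ π f).trans hzb⟩
    exact ⟨closure {y}, (mem_componentsIn_iff (hclosed _)).mpr ⟨y, hy, rfl, hmin⟩⟩
  intro F hF
  obtain ⟨f, hf, rfl, hmin⟩ := (mem_componentsIn_iff (hclosed _)).mp hF
  obtain ⟨hfZ, hfb⟩ := hE f hf
  have hfI := hZi₀ ⟨hfZ, hfb⟩
  obtain ⟨χ⟩ := hσ.nonempty_adaptedChart (π := π) hZreg (hDcartier i) hfZ hfb
  have hcomp : closure {f} ∈ componentsIn ((D'.support : Set V') ∩ (σ ≫ π) ⁻¹' {b}) := by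
    refine (mem_componentsIn_iff (hclosed _)).mpr
      ⟨f, ⟨χ.mem_support_of_mul_pow_eq hD' hCi hfZ hfI hZi, hf.2⟩, rfl, fun y hy hyf ↦ ?_⟩
    refine χ.eq_of_specializes_of_mem_support hDcartier hDprime hDfiber hb ?_ hf hmin hy.1 hy.2 hyf
    intro U
    rw [← hD']
    exact (Ideal.mul_le_left : D'.ideal U * (Z.comap σ ^ (2 * (a / 2))).ideal U ≤ D'.ideal U)
  have hnew : closure (σ '' closure {f}) ∉
      componentsIn (((∏ j, D j).support : Set V) ∩ π ⁻¹' {b}) := by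
    intro h
    obtain ⟨w, -, hw, hwmin⟩ := (mem_componentsIn_iff
      ((∏ j, D j).support.isClosed.inter (hb.preimage π.continuous))).mp h
    rw [closure_image_closure σ.continuous, Set.image_singleton] at hw
    -- Both points have the same closure, so $\sigma(f)$ would be the generic point of the alleged
    -- component.
    have hwf : σ f = w := by
      refine (Specializes.antisymm ?_ ?_).eq <;> rw [specializes_iff_closure_subset, hw]
    subst hwf
    obtain ⟨y, hy, hyf, hne⟩ := χ.exists_specializes_ne hc hb hZfiber hfZ hfb hfI
    exact hne (hwmin y ⟨support_subset_support_prod _ _ (Finset.mem_univ i) hy.1, hy.2⟩ hyf)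
  refine ⟨hcomp, hnew, ?_, fun X' p' hp' ↦ ?_, fun X p hp ↦ ?_⟩
  · exact closure_minimal (Set.singleton_subset_iff.mpr (χ.mem_strictTransform hfZ hfI hZi))
      isClosed_closure
  · rwa [hp'.fiberBranchLocus_eq]
  · rwa [hp.fiberBranchLocus_eq]
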